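/- **Setting.** For $i\in\{0,1\}$ let $\alpha_i(z'\mid z)$, $z,z'\in\{0,1,2,3\}$, be a stochastic matrix, and let $c,c_{\mathrm I},c_{\mathrm{II}}>0$. A hypothesis $H\in\{0,1\}$ ($0$ = news, $1$ = misinformation; $H_i$ is the event $H=i$) has $\Pr(H_1)=\pi_1\in[0,1]$. Given $H=i$, the observations $Z_1,Z_2,\dots$ form a Markov chain on $\{0,1,2,3\}$ with transition probabilities $\alpha_i$ and with $Z_1$ uniform. Put $\Pi_k=\Pr(H_1\mid Z_1,\dots,Z_k)$ and $g(\pi)=\min\{c_{\mathrm{II}}\pi,\;c_{\mathrm I}(1-\pi)\}$. The admissible times are the stopping times $T\in\{1,2,\dots\}\cup\{\infty\}$ of $(Z_k)_{k\ge1}$; a policy $(T,\delta)$ consists of an admissible time $T$ and a declaration $\delta\in\{0,1\}$ depending only on $Z_1,\dots,Z_T$. Consider the two problems $$\inf_{T}\ E\big[g(\Pi_T)+c\,T\,\Pi_T\big]\qquad\text{and}\qquad \inf_{(T,\delta)}\ c_{\mathrm I}\Pr(\delta=1\mid H_0)(1-\pi_1)+c_{\mathrm{II}}\Pr(\delta=0\mid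 H_1)\,\pi_1+E\big[c\,T\,\mathbb 1_{H_1}\big],$$ where, on $\{T=\infty\}$, nothing is declared, $\Pi_\infty=\lim_k\Pi_k$, and $\infty\cdot 0=0$. **Theorem.** (a) There is exactly one nonnegative family of functions $s^{(z)}:[0,1]\to[0,\infty)$, $z\in\{0,1,2,3\}$, that solves the time-independent Bellman equation $$s^{(z)}(\pi)=\min\Big\{g(\pi),\ E\big[s^{(Z_{k+1})}(\Pi_{k+1})\mid \Pi_k=\pi,Z_k=z\big]+c\pi\Big\},$$ where $$E\big[s^{(Z_{k+1})}(\Pi_{k+1})\mid \Pi_k=\pi,Z_k=z\big]=\sum_{z'=0}^{3}s^{(z')}\!\left(\frac{\pi\alpha_1(z'\mid z)}{\pi\alpha_1(z'\mid z)+(1-\pi)\alpha_0(z'\mid z)}\right)\big(\pi\alpha_1(z'\mid z)+(1-\pi)\alpha_0(z'\mid z)\big)$$ (terms with weight $0$ are $0$). From it define the 8 thresholds $$\pi_l^{(z)}=\sup\Big\{0\le\pi\le\tfrac{c_{\mathrm I}}{c_{\mathrm I}+c_{\mathrm{II}}}:\ s^{(z)}(\pi)=c_{\mathrm{II}}\pi\Big\},\qquad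 \pi_u^{(z)}=\inf\Big\{\tfrac{c_{\mathrm I}}{c_{\mathrm I}+c_{\mathrm{II}}}\le\pi\le1:\ s^{(z)}(\pi)=c_{\mathrm I}(1-\pi)\Big\}.$$ Both sets are nonempty, and the thresholds depend only on $\alpha_0,\alpha_1,c,c_{\mathrm I},c_{\mathrm{II}}$ (not on time). (b) For all $z$, $\pi_u^{(z)}>0$. If $\alpha_1(z'\mid z)=0$ whenever $\alpha_0(z'\mid z)=0$ (for instance, if all transition probabilities are positive), then also $\pi_l^{(z)}>0$ for all $z$. (c) For every prior $\pi_1\in[0,1]$, the time $$T^*=\inf\big\{k\ge1:\ \Pi_k\notin(\pi_l^{(Z_k)},\pi_u^{(Z_k)})\big\}\qquad(\inf\emptyset=\infty)$$ is an admissible time and attains the first infimum. There is an admissible declaration that at $T^*=k<\infty$ declares news only if $\Pi_k\le\pi_l^{(Z_k)}$ and misinformation only if $\Pi_k\ge\pi_u^{(Z_k)}$, and $T^*$ together with any such declaration attains the second infimum. Under the condition in (b), $T^*<\infty$ almost surely. -/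

import Mathlib

open MeasureTheory ProbabilityTheory
open scoped ENNReal

/-- `α i z z'` is the probability `α_i(z' | z)` of moving from edge type `z` to edge type `z'` when
the information is news (`i = 0`) or misinformation (`i = 1`): each `α i` is a stochastic matrix. -/
structure IsTransitionFamily (α : Fin 2 → Fin 4 → Fin 4 → ℝ) : Prop where
  nonneg : ∀ i z z', 0 ≤ α i z z'
  sum_eq_one : ∀ i z, ∑ z', α i z z' = 1

section Model

variable {Ω : Type*} [MeasurableSpace Ω]

/-- The hypothesis `H` (`0` = news, `1` = misinformation) and the observations `Z 1, Z 2, …`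
(the variable `Z 0` plays no role): `H = 1` has prior probability `π₁`; given `H`, the first
observation is uniform on the four edge types and `Z 1, Z 2, …` is a Markov chain with transition
probabilities `α H`. The conditional statements are written as products, so that they make sense
also when a hypothesis or a path has probability zero. -/
structure IsObservationModel (P : Measure Ω) (π₁ : ℝ) (α : Fin 2 → Fin 4 → Fin 4 → ℝ)
    (H : Ω → Fin 2) (Z : ℕ → Ω → Fin 4) : Prop where
  measurable_hypothesis : Measurable H
  prior : P.real {ω | H ω = 1} = π₁
  initial : ∀ (i : Fin 2) (z : Fin 4),
    P.real {ω | H ω = i ∧ Z 1 ω = z} = P.real {ω | H ω = i} * (1 / 4)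
  markov : ∀ (i : Fin 2) (k : ℕ), 1 ≤ k → ∀ z : ℕ → Fin 4,
    P.real {ω | H ω = i ∧ ∀ j ∈ Finset.Icc 1 (k + 1), Z j ω = z j} =
      P.real {ω | H ω = i ∧ ∀ j ∈ Finset.Icc 1 k, Z j ω = z j} * α i (z k) (z (k + 1))

/-- The filtration `ℱ_k = σ(Z 1, …, Z k)`; `ℱ_0` is trivial. -/
def obsFiltration (Z : ℕ → Ω → Fin 4) (hZ : ∀ k, Measurable (Z k)) :
    Filtration ℕ (inferInstance : MeasurableSpace Ω) where
  seq k := ⨆ j ∈ Finset.Icc 1 k, MeasurableSpace.comap (Z j) ⊤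
  mono' := fun _ _ hkl =>
    biSup_mono fun _ hj => Finset.mem_Icc.2
      ⟨(Finset.mem_Icc.1 hj).1, (Finset.mem_Icc.1 hj).2.trans hkl⟩
  le' := fun _ => iSup₂_le fun j _ => (hZ j).comap_le

/-- The posterior `Π_k = Pr(H = 1 | Z_1, …, Z_k)`: at `ω` it is the elementary conditional
probability given that the first `k` observations are those seen at `ω`. -/
noncomputable def posterior (P : Measure Ω) (H : Ω → Fin 2) (Z : ℕ → Ω → Fin 4) (k : ℕ)
    (ω : Ω) : ℝ :=
  (P[|{ω' | ∀ j ∈ Finset.Icc 1 k, Z j ω' = Z j ω}]).real {ω' | H ω' = 1}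

/-- The posterior `Π_T` at a time `t ∈ {1, 2, …, ∞}`. At `t = ∞` it is the limit of `Π_k` (which
exists almost surely). -/
noncomputable def posteriorAt (P : Measure Ω) (H : Ω → Fin 2) (Z : ℕ → Ω → Fin 4) (t : ℕ∞)
    (ω : Ω) : ℝ :=
  match t with
  | ⊤ => Filter.limsup (fun k : ℕ => posterior P H Z k ω) Filter.atTop
  | (k : ℕ) => posterior P H Z k ω

/-- The admissible times: stopping times `T ≥ 1` of the observations, possibly infinite. -/
def IsAdmissibleTime (Z : ℕ → Ω → Fin 4) (hZ : ∀ k, Measurable (Z k)) (T : Ω → ℕ∞) : Prop :=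
  IsStoppingTime (obsFiltration Z hZ) T ∧ ∀ ω, 1 ≤ T ω

/-- An admissible policy: an admissible time `T` and a declared type `δ` (`0` = news,
`1` = misinformation) that depends on `Z_1, …, Z_T` only. -/
def IsAdmissiblePolicy (Z : ℕ → Ω → Fin 4) (hZ : ∀ k, Measurable (Z k)) (T : Ω → ℕ∞)
    (δ : Ω → Fin 2) : Prop :=
  (∀ ω, 1 ≤ T ω) ∧
    ∃ hT : IsStoppingTime (obsFiltration Z hZ) T, Measurable[hT.measurableSpace] δ

end Model

/-- The error cost of the better declaration at belief `π`: `g(π) = min {c_II π, c_I (1 - π)}`. -/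
noncomputable def errorCost (cI cII π : ℝ) : ℝ := min (cII * π) (cI * (1 - π))

section Costs

variable {Ω : Type*} [MeasurableSpace Ω]

/-- The cost `E[g(Π_T) + c T Π_T]` of a time `T`, in `[0, ∞]`, with `∞ * 0 = 0`. -/
noncomputable def stoppingCost (P : Measure Ω) (H : Ω → Fin 2) (Z : ℕ → Ω → Fin 4)
    (c cI cII : ℝ) (T : Ω → ℕ∞) : ℝ≥0∞ :=
  ∫⁻ ω, ENNReal.ofReal (errorCost cI cII (posteriorAt P H Z (T ω) ω)) +
    ENNReal.ofReal c * (T ω : ℝ≥0∞) * ENNReal.ofReal (posteriorAt P H Z (T ω) ω) ∂P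

/-- The cost `c_I Pr(δ = 1 | H_0) (1 - π₁) + c_II Pr(δ = 0 | H_1) π₁ + E[c T 1_{H_1}]` of a policy,
in `[0, ∞]`, with `∞ * 0 = 0`. Nothing is declared where `T = ∞`. -/
noncomputable def detectionCost (P : Measure Ω) (H : Ω → Fin 2) (π₁ c cI cII : ℝ)
    (T : Ω → ℕ∞) (δ : Ω → Fin 2) : ℝ≥0∞ :=
  ENNReal.ofReal cI * P[|{ω | H ω = 0}] {ω | T ω ≠ ⊤ ∧ δ ω = 1} * ENNReal.ofReal (1 - π₁) +
    ENNReal.ofReal cII * P[|{ω | H ω = 1}] {ω | T ω ≠ ⊤ ∧ δ ω = 0} * ENNReal.ofReal π₁ +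
    ∫⁻ ω, {ω | H ω = 1}.indicator (fun ω => ENNReal.ofReal c * (T ω : ℝ≥0∞)) ω ∂P

/-- `T* = inf {k ≥ 1 : Π_k ∉ (πl^{(Z_k)}, πu^{(Z_k)})}`, with `inf ∅ = ∞`. -/
noncomputable def thresholdTime (P : Measure Ω) (H : Ω → Fin 2) (Z : ℕ → Ω → Fin 4)
    (πl πu : Fin 4 → ℝ) (ω : Ω) : ℕ∞ :=
  ⨅ (k : ℕ) (_ : 1 ≤ k) (_ : posterior P H Z k ω ∉ Set.Ioo (πl (Z k ω)) (πu (Z k ω))), (k : ℕ∞)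

/-- The declaration `δ` follows the thresholds at time `T`: it is news only when
`Π_T ≤ πl^{(Z_T)}` and misinformation only when `Π_T ≥ πu^{(Z_T)}`. (If both inequalities hold,
that is, `Π_T = πl^{(Z_T)} = πu^{(Z_T)}`, both declarations are allowed.) -/
def IsThresholdDeclaration (P : Measure Ω) (H : Ω → Fin 2) (Z : ℕ → Ω → Fin 4)
    (πl πu : Fin 4 → ℝ) (T : Ω → ℕ∞) (δ : Ω → Fin 2) : Prop :=
  ∀ (ω : Ω) (k : ℕ), T ω = k →
    (δ ω = 0 ∧ posterior P H Z k ω ≤ πl (Z k ω)) ∨ (δ ω = 1 ∧ πu (Z k ω) ≤ posterior P H Z k ω)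

end Costs

/-- Given belief `π` and current edge type `z`, the probability that the next edge type is `z'`. -/
def nextProb (α : Fin 2 → Fin 4 → Fin 4 → ℝ) (z z' : Fin 4) (π : ℝ) : ℝ :=
  π * α 1 z z' + (1 - π) * α 0 z z'

/-- The belief updated by Bayes' rule after moving from edge type `z` to edge type `z'`. -/
noncomputable def nextBelief (α : Fin 2 → Fin 4 → Fin 4 → ℝ) (z z' : Fin 4) (π : ℝ) : ℝ :=
  π * α 1 z z' / nextProb α z z' π

/-- `s` is a nonnegative solution on `[0, 1]` of the Bellman equation
`s^{(z)}(π) = min {g(π), E[s^{(Z_{k+1})}(Π_{k+1}) | Π_k = π, Z_k = z] + c π}`. -/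
structure IsBellmanSolution (α : Fin 2 → Fin 4 → Fin 4 → ℝ) (c cI cII : ℝ)
    (s : Fin 4 → ℝ → ℝ) : Prop where
  nonneg : ∀ z, ∀ π ∈ Set.Icc (0 : ℝ) 1, 0 ≤ s z π
  bellman : ∀ z, ∀ π ∈ Set.Icc (0 : ℝ) 1,
    s z π = min (errorCost cI cII π)
      (∑ z', s z' (nextBelief α z z' π) * nextProb α z z' π + c * π)

/-- The beliefs in `[0, c_I / (c_I + c_II)]` at which `s^{(z)}(π) = c_II π`. -/
def newsSet (cI cII : ℝ) (s : Fin 4 → ℝ → ℝ) (z : Fin 4) : Set ℝ :=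
  {π | 0 ≤ π ∧ π ≤ cI / (cI + cII) ∧ s z π = cII * π}

/-- The beliefs in `[c_I / (c_I + c_II), 1]` at which `s^{(z)}(π) = c_I (1 - π)`. -/
def misinfoSet (cI cII : ℝ) (s : Fin 4 → ℝ → ℝ) (z : Fin 4) : Set ℝ :=
  {π | cI / (cI + cII) ≤ π ∧ π ≤ 1 ∧ s z π = cI * (1 - π)}

/-- The lower threshold `πl^{(z)}`. -/
noncomputable def lowerThreshold (cI cII : ℝ) (s : Fin 4 → ℝ → ℝ) (z : Fin 4) : ℝ :=
  sSup (newsSet cI cII s z)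

/-- The upper threshold `πu^{(z)}`. -/
noncomputable def upperThreshold (cI cII : ℝ) (s : Fin 4 → ℝ → ℝ) (z : Fin 4) : ℝ :=
  sInf (misinfoSet cI cII s z)

/-! ### Bayes' rule for one transition. -/

section Updates

variable {α : Fin 2 → Fin 4 → Fin 4 → ℝ} {z z' : Fin 4} {π : ℝ}

/-! Existence. The Bellman operator is monotone, so its iterates from `0` increase; they stay below
`g`, and their pointwise limit solves the equation. The operator also preserves concavity in the
belief, because the perspective of a concave function along the Bayes update is concave. Hence the
limit is concave.

Uniqueness. The operator need not contract in the sup norm, but every solution is at most `c_II π`,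
so the running cost `c π` dominates a fixed multiple `ε` of it. If `l t ≤ s` for two solutions, then
`(l + ε (1 - l)) t ≤ s`; iterating from `l = 0` gives `t ≤ s`, and symmetry gives equality
(`le_of_isBellmanSolution`).

Thresholds. A concave function lying below a line and touching it at an endpoint touches it on an
interval. So stopping is optional exactly outside the open interval between the thresholds, and
continuing is strictly better inside it. If all likelihood ratios are finite, a belief close enough
to `0` stays small for `n` updates; once `n c ≥ c_II`, waiting cannot pay, so the lower threshold is
positive.

Optimality. Let the cost `c` accrue at each step before `T` on `H = 1`. The accrued cost plus the
current value `s` is then a submartingale from time `1`, and keeps a constant mean while continuing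
is optimal. Stopping at `min T n` and letting `n → ∞` gives `initialValue_le_stoppedLoss` for every
`T` and the reverse bound for `T*`. In the lower bound the remainder is at most `c_II P(H = 1, n <
T)`, which vanishes when the loss is finite. Both original costs reduce to this loss: the detection
cost by conditioning on the observed path, the stopping cost also by Lévy's zero-one law on `T = ∞`.
-/

lemma nextProb_nonneg (hα : IsTransitionFamily α) (hπ : π ∈ Set.Icc (0 : ℝ) 1) :
    0 ≤ nextProb α z z' π :=
  add_nonneg (mul_nonneg hπ.1 (hα.nonneg ..))
    (mul_nonneg (sub_nonneg.2 hπ.2) (hα.nonneg ..))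

lemma mul_le_nextProb (hα : IsTransitionFamily α) (hπ : π ∈ Set.Icc (0 : ℝ) 1) :
    π * α 1 z z' ≤ nextProb α z z' π :=
  le_add_of_nonneg_right (mul_nonneg (sub_nonneg.2 hπ.2) (hα.nonneg ..))

lemma nextBelief_mem_Icc (hα : IsTransitionFamily α) (hπ : π ∈ Set.Icc (0 : ℝ) 1) :
    nextBelief α z z' π ∈ Set.Icc (0 : ℝ) 1 :=
  ⟨div_nonneg (mul_nonneg hπ.1 (hα.nonneg ..)) (nextProb_nonneg hα hπ),
    div_le_one_of_le₀ (mul_le_nextProb hα hπ) (nextProb_nonneg hα hπ)⟩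

/-- Holds also where the update is `0 / 0`: a transition of total weight zero has no weight under `H
= 1` either. -/
lemma nextBelief_mul_nextProb (hα : IsTransitionFamily α) (hπ : π ∈ Set.Icc (0 : ℝ) 1) :
    nextBelief α z z' π * nextProb α z z' π = π * α 1 z z' := by
  rcases eq_or_ne (nextProb α z z' π) 0 with h | h
  · have h1 := mul_le_nextProb (z := z) (z' := z') hα hπ
    have h2 : 0 ≤ π * α 1 z z' := mul_nonneg hπ.1 (hα.nonneg ..)
    rw [h] at h1 ⊢
    linarith
  · exact div_mul_cancel₀ _ h

/-- The martingale property of the belief. -/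
lemma sum_nextBelief_mul_nextProb (hα : IsTransitionFamily α) (hπ : π ∈ Set.Icc (0 : ℝ) 1) :
    ∑ z', nextBelief α z z' π * nextProb α z z' π = π := by
  simp only [nextBelief_mul_nextProb hα hπ, ← Finset.mul_sum, hα.sum_eq_one, mul_one]

lemma nextProb_convexCombination (x y a b : ℝ) (hab : a + b = 1) :
    nextProb α z z' (a * x + b * y) = a * nextProb α z z' x + b * nextProb α z z' y := by
  unfold nextProb
  linear_combination -(α 0 z z') * hab

/-- The perspective of a concave function along the Bayes update is concave. -/
lemma ConcaveOn.nextBelief_mul_nextProb (hα : IsTransitionFamily α) {f : ℝ → ℝ}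
    (hf : ConcaveOn ℝ (Set.Icc 0 1) f) :
    ConcaveOn ℝ (Set.Icc 0 1) fun π => f (nextBelief α z z' π) * nextProb α z z' π := by
  refine ⟨convex_Icc 0 1, fun x hx y hy a b ha hb hab => ?_⟩
  have hxy : a * x + b * y ∈ Set.Icc (0 : ℝ) 1 := convex_Icc (0 : ℝ) 1 hx hy ha hb hab
  simp only [smul_eq_mul]
  have hN := nextProb_convexCombination (α := α) (z := z) (z' := z') x y a b hab
  have hx0 := mul_nonneg ha (nextProb_nonneg (z := z) (z' := z') hα hx)
  have hy0 := mul_nonneg hb (nextProb_nonneg (z := z) (z' := z') hα hy)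
  have e := _root_.nextBelief_mul_nextProb (z := z) (z' := z') hα hxy
  have ex := _root_.nextBelief_mul_nextProb (z := z) (z' := z') hα hx
  have ey := _root_.nextBelief_mul_nextProb (z := z) (z' := z') hα hy
  set N := nextProb α z z' (a * x + b * y)
  set nx := nextProb α z z' x
  set ny := nextProb α z z' y
  set B := nextBelief α z z' (a * x + b * y)
  set bx := nextBelief α z z' x
  set by' := nextBelief α z z' y
  rcases eq_or_ne N 0 with h | h
  · have h1 : a * nx = 0 := by linarith
    have h2 : b * ny = 0 := by linarith
    have : a * (f bx * nx) + b * (f by' * ny) = 0 := by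
      linear_combination f bx * h1 + f by' * h2
    rw [this, h, mul_zero]
  -- The update of a mixture is a mixture of the updates, with weights `a * nx / N` and `b * ny /
  -- N`; concavity is applied with these weights and multiplied by `N`.
  · have hNpos : 0 < N := lt_of_le_of_ne (by linarith) h.symm
    have key := hf.2 (nextBelief_mem_Icc (z := z) (z' := z') hα hx)
      (nextBelief_mem_Icc (z := z) (z' := z') hα hy)
      (div_nonneg hx0 hNpos.le) (div_nonneg hy0 hNpos.le)
      (by rw [← add_div, ← hN, div_self h])
    have hB : (a * nx / N) • bx + (b * ny / N) • by' = B := by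
      simp only [smul_eq_mul]
      field_simp
      linear_combination a * ex + b * ey - e
    rw [hB] at key
    have := mul_le_mul_of_nonneg_right key hNpos.le
    refine le_trans (le_of_eq ?_) this
    change _ = (a * nx / N * f bx + b * ny / N * f by') * N
    field_simp

end Updates

/-! ### The Bellman operator: iterates from `0` and their limit. -/

section Bellman

variable {α : Fin 2 → Fin 4 → Fin 4 → ℝ} {c cI cII : ℝ}

/-- The expected cost of continuing: `E[s^{(Z_{k+1})}(Π_{k+1}) | Π_k = π, Z_k = z] + c π`. -/
noncomputable def continuationCost (α : Fin 2 → Fin 4 → Fin 4 → ℝ) (c : ℝ) (s : Fin 4 → ℝ → ℝ)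
    (z : Fin 4) (π : ℝ) : ℝ :=
  ∑ z', s z' (nextBelief α z z' π) * nextProb α z z' π + c * π

lemma continuationCost_mono (hα : IsTransitionFamily α) {s t : Fin 4 → ℝ → ℝ}
    (h : ∀ z, ∀ π ∈ Set.Icc (0 : ℝ) 1, s z π ≤ t z π) (z : Fin 4) {π : ℝ}
    (hπ : π ∈ Set.Icc (0 : ℝ) 1) : continuationCost α c s z π ≤ continuationCost α c t z π :=
  add_le_add_left (Finset.sum_le_sum fun _ _ =>
    mul_le_mul_of_nonneg_right (h _ _ (nextBelief_mem_Icc hα hπ)) (nextProb_nonneg hα hπ)) _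

lemma continuationCost_nonneg (hα : IsTransitionFamily α) (hc : 0 < c) {s : Fin 4 → ℝ → ℝ}
    (h : ∀ z, ∀ π ∈ Set.Icc (0 : ℝ) 1, 0 ≤ s z π) (z : Fin 4) {π : ℝ}
    (hπ : π ∈ Set.Icc (0 : ℝ) 1) : 0 ≤ continuationCost α c s z π :=
  add_nonneg (Finset.sum_nonneg fun _ _ =>
    mul_nonneg (h _ _ (nextBelief_mem_Icc hα hπ)) (nextProb_nonneg hα hπ)) (mul_nonneg hc.le hπ.1)

lemma errorCost_nonneg (hcI : 0 < cI) (hcII : 0 < cII) {π : ℝ} (hπ : π ∈ Set.Icc (0 : ℝ) 1) :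
    0 ≤ errorCost cI cII π :=
  le_min (mul_nonneg hcII.le hπ.1) (mul_nonneg hcI.le (sub_nonneg.2 hπ.2))

lemma errorCost_eq_left (hcI : 0 < cI) (hcII : 0 < cII) {π : ℝ} (h : π ≤ cI / (cI + cII)) :
    errorCost cI cII π = cII * π :=
  min_eq_left (by rw [le_div_iff₀ (by positivity)] at h; linarith)

lemma errorCost_eq_right (hcI : 0 < cI) (hcII : 0 < cII) {π : ℝ} (h : cI / (cI + cII) ≤ π) :
    errorCost cI cII π = cI * (1 - π) :=
  min_eq_right (by rw [div_le_iff₀ (by positivity)] at h; linarith)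

lemma concaveOn_errorCost : ConcaveOn ℝ (Set.Icc 0 1) (errorCost cI cII) := by
  refine ConcaveOn.inf ⟨convex_Icc 0 1, fun x _ y _ a b _ _ _ => le_of_eq ?_⟩
    ⟨convex_Icc 0 1, fun x _ y _ a b _ _ h => le_of_eq ?_⟩
  · simp only [smul_eq_mul]; ring
  · simp only [smul_eq_mul]; linear_combination cI * h

lemma concaveOn_continuationCost (hα : IsTransitionFamily α) {s : Fin 4 → ℝ → ℝ}
    (h : ∀ z, ConcaveOn ℝ (Set.Icc 0 1) (s z)) (z : Fin 4) :
    ConcaveOn ℝ (Set.Icc 0 1) (continuationCost α c s z) := by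
  refine ConcaveOn.add ?_ ⟨convex_Icc 0 1, fun x _ y _ a b _ _ _ => le_of_eq ?_⟩
  · simp only [Fin.sum_univ_four]
    exact ((((h _).nextBelief_mul_nextProb hα).add ((h _).nextBelief_mul_nextProb hα)).add
      ((h _).nextBelief_mul_nextProb hα)).add ((h _).nextBelief_mul_nextProb hα)
  · simp only [smul_eq_mul]; ring

/-- The iterates of the Bellman operator from `0`: the optimal costs over finite horizons when the
terminal cost is `0`. -/
noncomputable def bellmanIterate (α : Fin 2 → Fin 4 → Fin 4 → ℝ) (c cI cII : ℝ) :
    ℕ → Fin 4 → ℝ → ℝ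
  | 0 => fun _ _ => 0
  | n + 1 => fun z π =>
      min (errorCost cI cII π) (continuationCost α c (bellmanIterate α c cI cII n) z π)

/-- The limit of the Bellman iterates. -/
noncomputable def bellmanLimit (α : Fin 2 → Fin 4 → Fin 4 → ℝ) (c cI cII : ℝ) (z : Fin 4)
    (π : ℝ) : ℝ :=
  ⨆ n, bellmanIterate α c cI cII n z π

lemma bellmanIterate_nonneg (hα : IsTransitionFamily α) (hc : 0 < c) (hcI : 0 < cI)
    (hcII : 0 < cII) (n : ℕ)
    (z : Fin 4) (π : ℝ) (hπ : π ∈ Set.Icc (0 : ℝ) 1) :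
    0 ≤ bellmanIterate α c cI cII n z π := by
  induction n generalizing z π with
  | zero => exact le_rfl
  | succ n ih => exact le_min (errorCost_nonneg hcI hcII hπ) (continuationCost_nonneg hα hc ih z hπ)

lemma bellmanIterate_le_errorCost (hcI : 0 < cI) (hcII : 0 < cII) (n : ℕ)
    (z : Fin 4) (π : ℝ) (hπ : π ∈ Set.Icc (0 : ℝ) 1) :
    bellmanIterate α c cI cII n z π ≤ errorCost cI cII π := by
  cases n with
  | zero => exact errorCost_nonneg hcI hcII hπ
  | succ n => exact min_le_left _ _

lemma bellmanIterate_mono (hα : IsTransitionFamily α) (hc : 0 < c) (hcI : 0 < cI)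
    (hcII : 0 < cII) (z : Fin 4) (π : ℝ) (hπ : π ∈ Set.Icc (0 : ℝ) 1) :
    Monotone fun n => bellmanIterate α c cI cII n z π := by
  refine monotone_nat_of_le_succ fun n => ?_
  induction n generalizing z π with
  | zero => exact bellmanIterate_nonneg hα hc hcI hcII 1 z π hπ
  | succ n ih => exact min_le_min_left _ (continuationCost_mono hα ih z hπ)

lemma concaveOn_bellmanIterate (hα : IsTransitionFamily α) (n : ℕ) (z : Fin 4) :
    ConcaveOn ℝ (Set.Icc 0 1) (bellmanIterate α c cI cII n z) := by
  induction n generalizing z with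
  | zero => exact concaveOn_const 0 (convex_Icc 0 1)
  | succ n ih => exact concaveOn_errorCost.inf (concaveOn_continuationCost hα ih z)

lemma tendsto_bellmanIterate (hα : IsTransitionFamily α) (hc : 0 < c) (hcI : 0 < cI)
    (hcII : 0 < cII) (z : Fin 4) (π : ℝ) (hπ : π ∈ Set.Icc (0 : ℝ) 1) :
    Filter.Tendsto (fun n => bellmanIterate α c cI cII n z π) Filter.atTop
      (nhds (bellmanLimit α c cI cII z π)) := by
  refine tendsto_atTop_ciSup (bellmanIterate_mono hα hc hcI hcII z π hπ)
    ⟨errorCost cI cII π, ?_⟩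
  rintro _ ⟨n, rfl⟩
  exact bellmanIterate_le_errorCost hcI hcII n z π hπ

lemma isBellmanSolution_bellmanLimit (hα : IsTransitionFamily α) (hc : 0 < c) (hcI : 0 < cI)
    (hcII : 0 < cII) :
    IsBellmanSolution α c cI cII (bellmanLimit α c cI cII) where
  nonneg z π hπ := ge_of_tendsto' (tendsto_bellmanIterate hα hc hcI hcII z π hπ)
    fun n => bellmanIterate_nonneg hα hc hcI hcII n z π hπ
  bellman z π hπ := by
    refine tendsto_nhds_unique
      ((tendsto_bellmanIterate hα hc hcI hcII z π hπ).comp (Filter.tendsto_add_atTop_nat 1)) ?_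
    refine Filter.Tendsto.min tendsto_const_nhds (Filter.Tendsto.add ?_ tendsto_const_nhds)
    exact tendsto_finsetSum _ fun z' _ =>
      (tendsto_bellmanIterate hα hc hcI hcII z' _ (nextBelief_mem_Icc hα hπ)).mul_const _

lemma concaveOn_bellmanLimit (hα : IsTransitionFamily α) (hc : 0 < c) (hcI : 0 < cI)
    (hcII : 0 < cII) (z : Fin 4) :
    ConcaveOn ℝ (Set.Icc 0 1) (bellmanLimit α c cI cII z) := by
  refine ⟨convex_Icc 0 1, fun x hx y hy a b ha hb hab => ?_⟩
  refine le_of_tendsto_of_tendsto'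
    (((tendsto_bellmanIterate hα hc hcI hcII z x hx).const_mul a).add
      ((tendsto_bellmanIterate hα hc hcI hcII z y hy).const_mul b))
    (tendsto_bellmanIterate hα hc hcI hcII z _ (convex_Icc (0 : ℝ) 1 hx hy ha hb hab))
    fun n => (concaveOn_bellmanIterate hα n z).2 hx hy ha hb hab

/-! ### Uniqueness of the solution, and its behaviour near belief `0`. -/

namespace IsBellmanSolution

variable {s t : Fin 4 → ℝ → ℝ}

lemma eq_min (hs : IsBellmanSolution α c cI cII s) (z : Fin 4) {π : ℝ}
    (hπ : π ∈ Set.Icc (0 : ℝ) 1) :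
    s z π = min (errorCost cI cII π) (continuationCost α c s z π) := hs.bellman z π hπ

lemma le_errorCost (hs : IsBellmanSolution α c cI cII s) (z : Fin 4) {π : ℝ}
    (hπ : π ∈ Set.Icc (0 : ℝ) 1) : s z π ≤ errorCost cI cII π :=
  (hs.eq_min z hπ).trans_le (min_le_left _ _)

lemma le_continuationCost (hs : IsBellmanSolution α c cI cII s) (z : Fin 4) {π : ℝ}
    (hπ : π ∈ Set.Icc (0 : ℝ) 1) : s z π ≤ continuationCost α c s z π :=
  (hs.eq_min z hπ).trans_le (min_le_right _ _)

lemma eq_continuationCost (hs : IsBellmanSolution α c cI cII s) (z : Fin 4) {π : ℝ}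
    (hπ : π ∈ Set.Icc (0 : ℝ) 1) (h : s z π < errorCost cI cII π) :
    s z π = continuationCost α c s z π := by
  rcases min_choice (errorCost cI cII π) (continuationCost α c s z π) with h' | h'
  · exact absurd ((hs.eq_min z hπ).trans h') h.ne
  · exact (hs.eq_min z hπ).trans h'

lemma le_mul (hs : IsBellmanSolution α c cI cII s) (z : Fin 4) {π : ℝ}
    (hπ : π ∈ Set.Icc (0 : ℝ) 1) : s z π ≤ cII * π :=
  (hs.le_errorCost z hπ).trans (min_le_left _ _)

lemma le_mul_one_sub (hs : IsBellmanSolution α c cI cII s) (z : Fin 4) {π : ℝ}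
    (hπ : π ∈ Set.Icc (0 : ℝ) 1) : s z π ≤ cI * (1 - π) :=
  (hs.le_errorCost z hπ).trans (min_le_right _ _)

lemma apply_zero (hs : IsBellmanSolution α c cI cII s) (z : Fin 4) : s z 0 = 0 :=
  le_antisymm ((hs.le_mul z ⟨le_rfl, zero_le_one⟩).trans_eq (mul_zero _))
    (hs.nonneg z 0 ⟨le_rfl, zero_le_one⟩)

lemma apply_one (hs : IsBellmanSolution α c cI cII s) (z : Fin 4) : s z 1 = 0 :=
  le_antisymm ((hs.le_mul_one_sub z ⟨zero_le_one, le_rfl⟩).trans_eq (by simp))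
    (hs.nonneg z 1 ⟨zero_le_one, le_rfl⟩)

/-- One step of the contraction: the Bellman operator is subhomogeneous, strictly so because the
running cost `c π` dominates a multiple of every solution. -/
lemma mul_le_of_mul_le (hα : IsTransitionFamily α) (hs : IsBellmanSolution α c cI cII s)
    (ht : IsBellmanSolution α c cI cII t) {ε l : ℝ} (hl0 : 0 ≤ l) (hl : l ≤ 1) (hε0 : 0 ≤ ε)
    (hε1 : ε ≤ 1) (hε : ε * cII ≤ c)
    (h : ∀ z, ∀ π ∈ Set.Icc (0 : ℝ) 1, l * t z π ≤ s z π) (z : Fin 4) (π : ℝ)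
    (hπ : π ∈ Set.Icc (0 : ℝ) 1) : (1 - (1 - ε) * (1 - l)) * t z π ≤ s z π := by
  rw [hs.eq_min z hπ]
  have ht0 := ht.nonneg z π hπ
  refine le_min ?_ ?_
  · have := ht.le_errorCost z hπ
    have h2 : 0 ≤ (1 - ε) * (1 - l) * t z π :=
      mul_nonneg (mul_nonneg (sub_nonneg.2 hε1) (sub_nonneg.2 hl)) ht0
    linarith
  -- Only the future value is scaled by `l`, while the running cost is paid in full. The surplus `(1
  -- - l) c π` is at least `(1 - l) ε t`, since `t ≤ c_II π` and `ε c_II ≤ c`.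
  · have h1 : l * (continuationCost α c t z π - c * π) + c * π ≤ continuationCost α c s z π := by
      unfold continuationCost
      rw [add_sub_cancel_right, Finset.mul_sum]
      refine add_le_add_left (Finset.sum_le_sum fun z' _ => ?_) _
      rw [← mul_assoc]
      exact mul_le_mul_of_nonneg_right (h _ _ (nextBelief_mem_Icc hα hπ)) (nextProb_nonneg hα hπ)
    have h2 := ht.le_continuationCost z hπ
    have h3 : ε * t z π ≤ c * π := by
      have h4 := mul_le_mul_of_nonneg_left (ht.le_mul z hπ) hε0
      have h5 := mul_le_mul_of_nonneg_right hε hπ.1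
      linarith
    have h6 := mul_le_mul_of_nonneg_left h3 (sub_nonneg.2 hl)
    have := mul_le_mul_of_nonneg_left h2 hl0
    linarith

lemma le_of_isBellmanSolution (hα : IsTransitionFamily α) (hc : 0 < c) (hcII : 0 < cII)
    (hs : IsBellmanSolution α c cI cII s) (ht : IsBellmanSolution α c cI cII t) (z : Fin 4)
    (π : ℝ) (hπ : π ∈ Set.Icc (0 : ℝ) 1) : t z π ≤ s z π := by
  -- Capping at `1` keeps `1 - ε` in `[0, 1)`, so that its powers tend to `0`.
  set ε := min 1 (c / cII)
  have hε0 : 0 < ε := lt_min one_pos (div_pos hc hcII)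
  have hε1 : ε ≤ 1 := min_le_left _ _
  have hε : ε * cII ≤ c := (le_div_iff₀ hcII).1 (min_le_right _ _)
  have key : ∀ n : ℕ, ∀ z, ∀ π ∈ Set.Icc (0 : ℝ) 1, (1 - (1 - ε) ^ n) * t z π ≤ s z π := by
    intro n
    induction n with
    | zero => intro z π hπ; simpa using hs.nonneg z π hπ
    | succ n ih =>
      intro z π hπ
      have := mul_le_of_mul_le hα hs ht (l := 1 - (1 - ε) ^ n)
        (sub_nonneg.2 (pow_le_one₀ (sub_nonneg.2 hε1) (sub_le_self _ hε0.le)))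
        (sub_le_self _ (pow_nonneg (sub_nonneg.2 hε1) n))
        hε0.le hε1 hε ih z π hπ
      rwa [sub_sub_cancel, ← pow_succ'] at this
  have hlim : Filter.Tendsto (fun n : ℕ => (1 - (1 - ε) ^ n) * t z π) Filter.atTop
      (nhds ((1 - 0) * t z π)) :=
    ((tendsto_pow_atTop_nhds_zero_of_lt_one (sub_nonneg.2 hε1) (by linarith)).const_sub 1).mul_const
      _
  rw [sub_zero, one_mul] at hlim
  exact le_of_tendsto' hlim fun n => key n z π hπ


/-- Where every likelihood ratio is finite, beliefs near `0` stay near `0` after an update, and the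
accumulated observation costs exceed the error cost `c_II π`. -/
lemma exists_forall_eq_mul (hα : IsTransitionFamily α) (hc : 0 < c) (hcI : 0 < cI)
    (hcII : 0 < cII) (hs : IsBellmanSolution α c cI cII s)
    (habs : ∀ z z', α 0 z z' = 0 → α 1 z z' = 0) :
    ∃ η > 0, η ≤ cI / (cI + cII) ∧ ∀ z, ∀ π ∈ Set.Icc (0 : ℝ) η, s z π = cII * π := by
  have hp1 : cI / (cI + cII) < 1 := (div_lt_one (by positivity)).2 (by linarith)
  have hp0 : 0 < cI / (cI + cII) := by positivity
  have hbelief : ∀ η > 0, ∃ η' > 0, η' ≤ 1 / 2 ∧ ∀ z z', ∀ π ∈ Set.Icc (0 : ℝ) η',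
      nextBelief α z z' π ≤ η := by
    intro η hη
    have hone : ∀ z z', ∃ η' > 0, η' ≤ 1 / 2 ∧ ∀ π ∈ Set.Icc (0 : ℝ) η',
        nextBelief α z z' π ≤ η := by
      intro z z'
      rcases (hα.nonneg 0 z z').eq_or_lt with h0 | h0
      · refine ⟨1 / 2, by norm_num, le_rfl, fun π _ => ?_⟩
        simp [nextBelief, habs z z' h0.symm, hη.le]
      · have h1 := hα.nonneg 1 z z'
        -- For `π ≤ 1/2` the news term alone gives `nextProb` at least `α 0 z z' / 2`, so the update
        -- is at most `2 π α 1 z z' / α 0 z z'`. The `+ 1` avoids a zero denominator.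
        refine ⟨min (1 / 2) (η * α 0 z z' / (2 * (α 1 z z' + 1))), by positivity,
          min_le_left _ _, fun π hπ => ?_⟩
        have ha := hπ.2.trans (min_le_left _ _)
        have hb := hπ.2.trans (min_le_right _ _)
        rw [le_div_iff₀ (by positivity)] at hb
        have hd : 0 < nextProb α z z' π :=
          add_pos_of_nonneg_of_pos (mul_nonneg hπ.1 h1) (mul_pos (by linarith) h0)
        refine (div_le_iff₀ hd).2 ?_
        unfold nextProb
        have e1 : 0 ≤ η * (π * α 1 z z') := mul_nonneg hη.le (mul_nonneg hπ.1 h1)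
        have e2 : 0 ≤ η * α 0 z z' * (1 / 2 - π) :=
          mul_nonneg (by positivity) (by linarith)
        have e3 := hπ.1
        linarith
    choose f hf0 hf1 hf using hone
    have hinf := fun z z' => Finset.inf'_le (fun p : Fin 4 × Fin 4 => f p.1 p.2)
      (Finset.mem_univ (z, z'))
    refine ⟨_, (Finset.lt_inf'_iff (Finset.univ_nonempty (α := Fin 4 × Fin 4))).2
      fun p _ => hf0 p.1 p.2, (hinf 0 0).trans (hf1 0 0), fun z z' π hπ => ?_⟩
    exact hf z z' π ⟨hπ.1, hπ.2.trans (hinf z z')⟩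
  -- Each Bellman step adds `c` to the slope of the lower bound, up to `c_II`, at the price of a
  -- smaller neighbourhood of `0`. The belief is a martingale, so a linear bound survives averaging.
  have key : ∀ n : ℕ, ∃ η > 0, η ≤ cI / (cI + cII) ∧
      ∀ z, ∀ π ∈ Set.Icc (0 : ℝ) η, min cII (n * c) * π ≤ s z π := by
    intro n
    induction n with
    | zero =>
      refine ⟨_, hp0, le_rfl, fun z π hπ => ?_⟩
      simpa [hcII.le] using hs.nonneg z π ⟨hπ.1, hπ.2.trans hp1.le⟩
    | succ n ih =>
      obtain ⟨η, hη0, -, hη⟩ := ih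
      obtain ⟨η', hη'0, hη'1, hη'⟩ := hbelief η hη0
      refine ⟨min η' (cI / (cI + cII)), lt_min hη'0 hp0, min_le_right _ _, fun z π hπ => ?_⟩
      have hπ1 := hπ.2.trans (min_le_left _ _)
      have hπ2 := hπ.2.trans (min_le_right _ _)
      have hπ' : π ∈ Set.Icc (0 : ℝ) 1 := ⟨hπ.1, hπ2.trans hp1.le⟩
      rw [hs.eq_min z hπ', errorCost_eq_left hcI hcII hπ2]
      refine le_min (mul_le_mul_of_nonneg_right (min_le_left _ _) hπ.1) ?_
      have h1 : min cII (n * c) * π ≤ ∑ z', s z' (nextBelief α z z' π) * nextProb α z z' π := by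
        conv_lhs => rw [← sum_nextBelief_mul_nextProb (z := z) hα hπ', Finset.mul_sum]
        refine Finset.sum_le_sum fun z' _ => ?_
        rw [← mul_assoc]
        exact mul_le_mul_of_nonneg_right
          (hη _ _ ⟨(nextBelief_mem_Icc hα hπ').1, hη' z z' π ⟨hπ.1, hπ1⟩⟩) (nextProb_nonneg hα hπ')
      have h2 : min cII ((n + 1 : ℕ) * c) ≤ min cII (n * c) + c := by
        rw [← min_add_add_right]
        push_cast
        exact min_le_min (by linarith) (by linarith)
      have h3 := mul_le_mul_of_nonneg_right h2 hπ.1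
      unfold continuationCost
      linarith
  obtain ⟨n, hn⟩ := exists_nat_ge (cII / c)
  obtain ⟨η, hη0, hη1, hη⟩ := key n
  rw [div_le_iff₀ hc] at hn
  rw [min_eq_left hn] at hη
  exact ⟨η, hη0, hη1, fun z π hπ =>
    le_antisymm (hs.le_mul z ⟨hπ.1, (hπ.2.trans hη1).trans hp1.le⟩) (hη z π hπ)⟩

end IsBellmanSolution

/-! ### Thresholds -/

/-- A concave function below an affine one that meets it at the left endpoint `0` meets it on the
whole closed interval up to the supremum of the contact set. -/
lemma ConcaveOn.eq_of_le_sSup {f : ℝ → ℝ} (hf : ConcaveOn ℝ (Set.Icc 0 1) f) {a b : ℝ}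
    (hle : ∀ x ∈ Set.Icc (0 : ℝ) 1, f x ≤ a * x + b) (h0 : f 0 = b) {S : Set ℝ}
    (hS : ∀ x ∈ S, 0 ≤ x ∧ f x = a * x + b) (hSne : S.Nonempty) (hS1 : sSup S < 1)
    (hbdd : BddAbove S) {x : ℝ} (hx0 : 0 ≤ x) (hx : x ≤ sSup S) : f x = a * x + b := by
  have hlt : ∀ y, 0 ≤ y → y < sSup S → f y = a * y + b := by
    intro y hy0 hy
    obtain ⟨q, hqS, hq⟩ := exists_lt_of_lt_csSup hSne hy
    have hq0 : 0 < q := hy0.trans_lt hq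
    have hq1 : q ≤ 1 := (le_csSup hbdd hqS).trans hS1.le
    -- By concavity `f` lies above its chord from `0` to the contact point `q`, and this chord is
    -- part of the given line.
    refine le_antisymm (hle y ⟨hy0, hq.le.trans hq1⟩) ?_
    have := hf.2 (show (0 : ℝ) ∈ Set.Icc (0 : ℝ) 1 from ⟨le_rfl, zero_le_one⟩)
      (show q ∈ Set.Icc (0 : ℝ) 1 from ⟨hq0.le, hq1⟩)
      (show 0 ≤ 1 - y / q from sub_nonneg.2 ((div_le_one hq0).2 hq.le))
      (div_nonneg hy0 hq0.le) (sub_add_cancel _ _)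
    simp only [smul_eq_mul, mul_zero, zero_add, h0, (hS q hqS).2, div_mul_cancel₀ _ hq0.ne'] at this
    refine le_trans (le_of_eq ?_) this
    field_simp
    ring
  rcases hx.lt_or_eq with hx | rfl
  · exact hlt x hx0 hx
  rcases hx0.eq_or_lt with h | h
  · rw [← h, h0]; ring
  -- The supremum need not belong to `S`. It is interior here, where a concave function is
  -- continuous, so contact passes to the limit from the left.
  have hcont : ContinuousAt f (sSup S) := by
    refine hf.continuousOn_interior.continuousAt (isOpen_interior.mem_nhds ?_)
    rw [interior_Icc]
    exact ⟨h, hS1⟩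
  refine tendsto_nhds_unique (hcont.tendsto.mono_left (nhdsWithin_le_nhds (s := Set.Iio (sSup S))))
    (Filter.Tendsto.congr' ?_
      ((by fun_prop : Continuous fun x => a * x + b).continuousAt.tendsto.mono_left nhdsWithin_le_nhds))
  filter_upwards [Ioo_mem_nhdsLT h] with y hy using (hlt y hy.1.le hy.2).symm

/-- The mirror image of `ConcaveOn.eq_of_le_sSup`. -/
lemma ConcaveOn.eq_of_sInf_le {f : ℝ → ℝ} (hf : ConcaveOn ℝ (Set.Icc 0 1) f) {a : ℝ}
    (hle : ∀ x ∈ Set.Icc (0 : ℝ) 1, f x ≤ a * (1 - x)) (h1 : f 1 = 0) {S : Set ℝ}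
    (hS : ∀ x ∈ S, x ≤ 1 ∧ f x = a * (1 - x)) (hSne : S.Nonempty) (hS0 : 0 < sInf S)
    (hbdd : BddBelow S) {x : ℝ} (hx1 : x ≤ 1) (hx : sInf S ≤ x) : f x = a * (1 - x) := by
  have hlt : ∀ y ≤ 1, sInf S < y → f y = a * (1 - y) := by
    intro y hy1 hy
    obtain ⟨q, hqS, hq⟩ := exists_lt_of_csInf_lt hSne hy
    have hq1 : 0 < 1 - q := by linarith
    have hq0 : 0 ≤ q := hS0.le.trans (csInf_le hbdd hqS)
    refine le_antisymm (hle y ⟨hq0.trans hq.le, hy1⟩) ?_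
    have := hf.2 (show (1 : ℝ) ∈ Set.Icc (0 : ℝ) 1 from ⟨zero_le_one, le_rfl⟩)
      (show q ∈ Set.Icc (0 : ℝ) 1 from ⟨hq0, (hS q hqS).1⟩)
      (show 0 ≤ 1 - (1 - y) / (1 - q) from sub_nonneg.2 ((div_le_one hq1).2 (by linarith)))
      (div_nonneg (by linarith) hq1.le) (sub_add_cancel _ _)
    have e : (1 - (1 - y) / (1 - q)) • 1 + ((1 - y) / (1 - q)) • q = y := by
      simp only [smul_eq_mul]
      field_simp
      ring
    rw [e, h1, (hS q hqS).2] at this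
    refine le_trans (le_of_eq ?_) this
    simp only [smul_eq_mul]
    field_simp
    ring
  rcases hx.lt_or_eq with hx | rfl
  · exact hlt x hx1 hx
  rcases hx1.eq_or_lt with h | h
  · rw [h, h1]; ring
  have hcont : ContinuousAt f (sInf S) := by
    refine hf.continuousOn_interior.continuousAt (isOpen_interior.mem_nhds ?_)
    rw [interior_Icc]
    exact ⟨hS0, h⟩
  refine tendsto_nhds_unique (hcont.tendsto.mono_left (nhdsWithin_le_nhds (s := Set.Ioi (sInf S))))
    (Filter.Tendsto.congr' ?_
      ((by fun_prop : Continuous fun x => a * (1 - x)).continuousAt.tendsto.mono_left nhdsWithin_le_nhds))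
  filter_upwards [Ioo_mem_nhdsGT h] with y hy using (hlt y hy.2.le hy.1).symm

lemma bddAbove_newsSet (cI cII : ℝ) (s : Fin 4 → ℝ → ℝ) (z : Fin 4) :
    BddAbove (newsSet cI cII s z) :=
  ⟨_, fun _ h => h.2.1⟩

lemma bddBelow_misinfoSet (cI cII : ℝ) (s : Fin 4 → ℝ → ℝ) (z : Fin 4) :
    BddBelow (misinfoSet cI cII s z) :=
  ⟨_, fun _ h => h.1⟩

namespace IsBellmanSolution

variable {s : Fin 4 → ℝ → ℝ}

lemma zero_mem_newsSet (hcI : 0 < cI) (hcII : 0 < cII) (hs : IsBellmanSolution α c cI cII s)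
    (z : Fin 4) : 0 ∈ newsSet cI cII s z :=
  ⟨le_rfl, by positivity, by rw [hs.apply_zero, mul_zero]⟩

lemma one_mem_misinfoSet (hcI : 0 < cI) (hcII : 0 < cII) (hs : IsBellmanSolution α c cI cII s)
    (z : Fin 4) : 1 ∈ misinfoSet cI cII s z :=
  ⟨(div_le_one (by positivity)).2 (by linarith), le_rfl, by rw [hs.apply_one, sub_self, mul_zero]⟩

lemma lowerThreshold_le (hcI : 0 < cI) (hcII : 0 < cII) (hs : IsBellmanSolution α c cI cII s)
    (z : Fin 4) : lowerThreshold cI cII s z ≤ cI / (cI + cII) :=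
  csSup_le ⟨0, hs.zero_mem_newsSet hcI hcII z⟩ fun _ h => h.2.1

lemma le_upperThreshold (hcI : 0 < cI) (hcII : 0 < cII) (hs : IsBellmanSolution α c cI cII s)
    (z : Fin 4) : cI / (cI + cII) ≤ upperThreshold cI cII s z :=
  le_csInf ⟨1, hs.one_mem_misinfoSet hcI hcII z⟩ fun _ h => h.1

lemma eq_mul_of_le_lowerThreshold (hcI : 0 < cI) (hcII : 0 < cII)
    (hs : IsBellmanSolution α c cI cII s) (hconc : ∀ z, ConcaveOn ℝ (Set.Icc 0 1) (s z))
    {z : Fin 4} {π : ℝ} (hπ : 0 ≤ π) (h : π ≤ lowerThreshold cI cII s z) : s z π = cII * π := by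
  have := (hconc z).eq_of_le_sSup (a := cII) (b := 0) (S := newsSet cI cII s z)
    (fun x hx => by simpa using hs.le_mul z hx) (hs.apply_zero z)
    (fun x hx => ⟨hx.1, by simpa using hx.2.2⟩) ⟨0, hs.zero_mem_newsSet hcI hcII z⟩
    ((hs.lowerThreshold_le hcI hcII z).trans_lt ((div_lt_one (by positivity)).2 (by linarith)))
    (bddAbove_newsSet ..) hπ h
  simpa using this

lemma eq_mul_of_upperThreshold_le (hcI : 0 < cI) (hcII : 0 < cII)
    (hs : IsBellmanSolution α c cI cII s) (hconc : ∀ z, ConcaveOn ℝ (Set.Icc 0 1) (s z))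
    {z : Fin 4} {π : ℝ} (hπ : π ≤ 1) (h : upperThreshold cI cII s z ≤ π) :
    s z π = cI * (1 - π) :=
  (hconc z).eq_of_sInf_le (S := misinfoSet cI cII s z)
    (fun x hx => hs.le_mul_one_sub z hx) (hs.apply_one z)
    (fun x hx => ⟨hx.2.1, hx.2.2⟩) ⟨1, hs.one_mem_misinfoSet hcI hcII z⟩
    (lt_of_lt_of_le (by positivity) (hs.le_upperThreshold hcI hcII z))
    (bddBelow_misinfoSet ..) hπ h

lemma lt_errorCost_of_mem_Ioo (hcI : 0 < cI) (hcII : 0 < cII)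
    (hs : IsBellmanSolution α c cI cII s) {z : Fin 4} {π : ℝ} (hπ : π ∈ Set.Icc (0 : ℝ) 1)
    (h : π ∈ Set.Ioo (lowerThreshold cI cII s z) (upperThreshold cI cII s z)) :
    s z π < errorCost cI cII π := by
  refine lt_of_le_of_ne (hs.le_errorCost z hπ) fun he => ?_
  rcases le_total π (cI / (cI + cII)) with hp | hp
  · rw [errorCost_eq_left hcI hcII hp] at he
    exact h.1.not_ge (le_csSup (bddAbove_newsSet ..) ⟨hπ.1, hp, he⟩)
  · rw [errorCost_eq_right hcI hcII hp] at he
    exact h.2.not_ge (csInf_le (bddBelow_misinfoSet ..) ⟨hp, hπ.2, he⟩)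

/-- This is where concavity enters: it makes the contact sets closed intervals reaching `0` and `1`,
so that stopping is optimal at the thresholds and everywhere beyond them. -/
lemma eq_errorCost_of_notMem_Ioo (hcI : 0 < cI) (hcII : 0 < cII)
    (hs : IsBellmanSolution α c cI cII s) (hconc : ∀ z, ConcaveOn ℝ (Set.Icc 0 1) (s z))
    {z : Fin 4} {π : ℝ} (hπ : π ∈ Set.Icc (0 : ℝ) 1)
    (h : π ∉ Set.Ioo (lowerThreshold cI cII s z) (upperThreshold cI cII s z)) :
    s z π = errorCost cI cII π := by
  rw [Set.mem_Ioo, not_and_or, not_lt, not_lt] at h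
  rcases h with h | h
  · rw [errorCost_eq_left hcI hcII (h.trans (hs.lowerThreshold_le hcI hcII z)),
      hs.eq_mul_of_le_lowerThreshold hcI hcII hconc hπ.1 h]
  · rw [errorCost_eq_right hcI hcII ((hs.le_upperThreshold hcI hcII z).trans h),
      hs.eq_mul_of_upperThreshold_le hcI hcII hconc hπ.2 h]

lemma upperThreshold_pos (hcI : 0 < cI) (hcII : 0 < cII) (hs : IsBellmanSolution α c cI cII s)
    (z : Fin 4) : 0 < upperThreshold cI cII s z :=
  lt_of_lt_of_le (by positivity) (hs.le_upperThreshold hcI hcII z)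

lemma lowerThreshold_pos (hα : IsTransitionFamily α) (hc : 0 < c) (hcI : 0 < cI)
    (hcII : 0 < cII) (hs : IsBellmanSolution α c cI cII s)
    (habs : ∀ z z', α 0 z z' = 0 → α 1 z z' = 0) (z : Fin 4) :
    0 < lowerThreshold cI cII s z := by
  obtain ⟨η, hη0, hη1, hη⟩ := hs.exists_forall_eq_mul hα hc hcI hcII habs
  exact hη0.trans_le (le_csSup (bddAbove_newsSet ..) ⟨hη0.le, hη1, hη z η ⟨hη0.le, le_rfl⟩⟩)

end IsBellmanSolution
end Bellman

/-! ### Observed paths: each `ℱ_k` is generated by finitely many cylinders. -/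

section Paths

variable {Ω : Type*} {Z : ℕ → Ω → Fin 4}

/-- The first `k` observations. -/
def obsPath (Z : ℕ → Ω → Fin 4) (k : ℕ) (ω : Ω) : Finset.Icc 1 k → Fin 4 := fun j => Z j ω

/-- The event that the first `k` observations are those seen at `ω`. -/
def pathCylinder (Z : ℕ → Ω → Fin 4) (k : ℕ) (ω : Ω) : Set Ω :=
  {ω' | ∀ j ∈ Finset.Icc 1 k, Z j ω' = Z j ω}

lemma pathCylinder_eq_preimage (k : ℕ) (ω : Ω) :
    pathCylinder Z k ω = obsPath Z k ⁻¹' {obsPath Z k ω} := by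
  ext ω'
  simp [pathCylinder, obsPath, funext_iff]

lemma pathCylinder_eq_of_mem {k : ℕ} {ω ω' : Ω} (h : ω' ∈ pathCylinder Z k ω) :
    pathCylinder Z k ω' = pathCylinder Z k ω := by
  rw [pathCylinder_eq_preimage] at h
  rw [pathCylinder_eq_preimage, pathCylinder_eq_preimage, Set.mem_singleton_iff.1 h]

lemma pathCylinder_succ (k : ℕ) (ω : Ω) :
    pathCylinder Z (k + 1) ω = pathCylinder Z k ω ∩ {ω' | Z (k + 1) ω' = Z (k + 1) ω} := by
  ext ω'
  simp only [pathCylinder, Finset.mem_Icc, Set.mem_inter_iff, Set.mem_ofPred_eq]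
  refine ⟨fun h => ⟨fun j hj => h j ⟨hj.1, by omega⟩, h _ ⟨by omega, le_rfl⟩⟩, fun h j hj => ?_⟩
  rcases hj.2.lt_or_eq with h' | rfl
  · exact h.1 j ⟨hj.1, by omega⟩
  · exact h.2

variable [MeasurableSpace Ω]

lemma obsFiltration_eq_comap (hZ : ∀ k, Measurable (Z k)) (k : ℕ) :
    obsFiltration Z hZ k = MeasurableSpace.comap (obsPath Z k) ⊤ := by
  apply le_antisymm
  · refine iSup₂_le fun j hj => ?_
    rintro _ ⟨B, -, rfl⟩
    exact ⟨{x | x ⟨j, hj⟩ ∈ B}, trivial, rfl⟩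
  · rintro _ ⟨B, -, rfl⟩
    have hX : Measurable[obsFiltration Z hZ k] (obsPath Z k) := by
      refine @measurable_pi_lambda _ _ _ (_) _ _ fun j => ?_
      exact Measurable.mono (ma := MeasurableSpace.comap (Z j) ⊤) (comap_measurable _)
        (le_iSup₂_of_le (f := fun j (_ : j ∈ Finset.Icc 1 k) => MeasurableSpace.comap (Z j) ⊤)
          j.1 j.2 le_rfl) le_rfl
    exact hX B.toFinite.measurableSet

lemma measurable_obsPath (hZ : ∀ k, Measurable (Z k)) (k : ℕ) : Measurable (obsPath Z k) :=
  measurable_pi_lambda _ fun j => hZ j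

lemma measurableSet_pathCylinder (hZ : ∀ k, Measurable (Z k)) (k : ℕ) (ω : Ω) :
    MeasurableSet (pathCylinder Z k ω) := by
  rw [pathCylinder_eq_preimage]
  exact measurable_obsPath hZ k (Set.toFinite _).measurableSet

/-- A function of the first `k` observations is measurable at time `k`. -/
lemma measurable_of_forall_pathCylinder (hZ : ∀ k, Measurable (Z k)) {k : ℕ} {β : Type*}
    [MeasurableSpace β] {f : Ω → β} (hf : ∀ ω, ∀ ω' ∈ pathCylinder Z k ω, f ω' = f ω) :
    Measurable[obsFiltration Z hZ k] f := by
  intro B _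
  rw [obsFiltration_eq_comap]
  refine ⟨obsPath Z k '' (f ⁻¹' B), trivial, ?_⟩
  ext ω
  refine ⟨?_, fun h => ⟨ω, h, rfl⟩⟩
  rintro ⟨ω', h', he⟩
  rw [Set.mem_preimage, hf ω' ω (by rw [pathCylinder_eq_preimage]; exact he.symm)]
  exact h'

/-- An event of `ℱ_k` is a finite disjoint union of path cylinders. This replaces conditional
expectations by elementary computations on one cylinder at a time. -/
lemma setLIntegral_le_of_forall_pathCylinder {P : Measure Ω} (hZ : ∀ k, Measurable (Z k)) {k : ℕ}
    {A : Set Ω} (hA : MeasurableSet[obsFiltration Z hZ k] A) {f g : Ω → ℝ≥0∞}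
    (h : ∀ ω ∈ A, ∫⁻ x in pathCylinder Z k ω, f x ∂P ≤ ∫⁻ x in pathCylinder Z k ω, g x ∂P) :
    ∫⁻ x in A, f x ∂P ≤ ∫⁻ x in A, g x ∂P := by
  have hA' := hA
  rw [obsFiltration_eq_comap] at hA
  obtain ⟨B, -, rfl⟩ := hA
  have hB : obsPath Z k ⁻¹' B = ⋃ x ∈ B.toFinite.toFinset, obsPath Z k ⁻¹' {x} := by
    ext ω; simp
  have hd : ((B.toFinite.toFinset : Finset _) : Set (Finset.Icc 1 k → Fin 4)).PairwiseDisjoint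
      fun x => obsPath Z k ⁻¹' {x} := fun x _ y _ hxy =>
    Disjoint.preimage _ (Set.disjoint_singleton.2 hxy)
  have hm : ∀ x ∈ B.toFinite.toFinset, MeasurableSet (obsPath Z k ⁻¹' {x}) := fun x _ =>
    measurable_obsPath hZ k (Set.toFinite _).measurableSet
  rw [hB, lintegral_biUnion_finset hd hm, lintegral_biUnion_finset hd hm]
  refine Finset.sum_le_sum fun x hx => ?_
  by_cases hne : ∃ ω, obsPath Z k ω = x
  · obtain ⟨ω, rfl⟩ := hne
    rw [← pathCylinder_eq_preimage]
    exact h ω (by simpa using hx)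
  · rw [show obsPath Z k ⁻¹' {x} = ∅ from
      Set.eq_empty_iff_forall_notMem.2 fun ω h => hne ⟨ω, h⟩]
    simp

lemma setLIntegral_eq_of_forall_pathCylinder {P : Measure Ω} (hZ : ∀ k, Measurable (Z k)) {k : ℕ}
    {A : Set Ω} (hA : MeasurableSet[obsFiltration Z hZ k] A) {f g : Ω → ℝ≥0∞}
    (h : ∀ ω ∈ A, ∫⁻ x in pathCylinder Z k ω, f x ∂P = ∫⁻ x in pathCylinder Z k ω, g x ∂P) :
    ∫⁻ x in A, f x ∂P = ∫⁻ x in A, g x ∂P :=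
  le_antisymm (setLIntegral_le_of_forall_pathCylinder hZ hA fun ω hω => (h ω hω).le)
    (setLIntegral_le_of_forall_pathCylinder hZ hA fun ω hω => (h ω hω).ge)

end Paths

/-! ### The posterior: Markov dynamics and limit. -/

section Posterior

variable {Ω : Type*} [MeasurableSpace Ω] {P : Measure Ω}
  {H : Ω → Fin 2} {Z : ℕ → Ω → Fin 4}

lemma posterior_eq_div (hZ : ∀ k, Measurable (Z k)) (k : ℕ) (ω : Ω) :
    posterior P H Z k ω =
      P.real ({ω | H ω = 1} ∩ pathCylinder Z k ω) / P.real (pathCylinder Z k ω) := by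
  change (P[|pathCylinder Z k ω]).real _ = _
  rw [measureReal_def, cond_apply (measurableSet_pathCylinder hZ k ω), ENNReal.toReal_mul,
    ENNReal.toReal_inv, Set.inter_comm, div_eq_inv_mul]
  rfl

lemma posterior_eq_of_mem {k : ℕ} {ω ω' : Ω} (h : ω' ∈ pathCylinder Z k ω) :
    posterior P H Z k ω' = posterior P H Z k ω := by
  change (P[|pathCylinder Z k ω']).real _ = (P[|pathCylinder Z k ω]).real _
  rw [pathCylinder_eq_of_mem h]

lemma setLIntegral_pathCylinder_of_forall_mem (hZ : ∀ k, Measurable (Z k)) {k : ℕ} {ω : Ω}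
    {f : Ω → ℝ≥0∞} (hf : ∀ ω' ∈ pathCylinder Z k ω, f ω' = f ω) :
    ∫⁻ x in pathCylinder Z k ω, f x ∂P = f ω * P (pathCylinder Z k ω) := by
  rw [setLIntegral_congr_fun (measurableSet_pathCylinder hZ k ω) hf, setLIntegral_const]

lemma setLIntegral_indicator_const {B : Set Ω} (hB : MeasurableSet B) (A : Set Ω) (a : ℝ≥0∞) :
    ∫⁻ x in A, B.indicator (fun _ => a) x ∂P = a * P (B ∩ A) := by
  rw [lintegral_indicator hB, setLIntegral_const, Measure.restrict_apply hB]

lemma measurable_posterior (hZ : ∀ k, Measurable (Z k)) (k : ℕ) :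
    Measurable[obsFiltration Z hZ k] (posterior P H Z k) :=
  measurable_of_forall_pathCylinder hZ fun _ _ h => posterior_eq_of_mem h

lemma IsObservationModel.real_hypothesis_inter_next {π₁ : ℝ} {α : Fin 2 → Fin 4 → Fin 4 → ℝ}
    (hM : IsObservationModel P π₁ α H Z)
    {k : ℕ} (hk : 1 ≤ k) (i : Fin 2) (z' : Fin 4) (ω : Ω) :
    P.real ({ω | H ω = i} ∩ (pathCylinder Z k ω ∩ {ω' | Z (k + 1) ω' = z'})) =
      P.real ({ω | H ω = i} ∩ pathCylinder Z k ω) * α i (Z k ω) z' := by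
  -- The path seen at `ω` up to time `k`, with its next entry replaced by `z'`.
  have := hM.markov i k hk fun j => if j = k + 1 then z' else Z j ω
  have hlt : ∀ j ∈ Finset.Icc 1 k, j ≠ k + 1 := fun j hj => by
    have := (Finset.mem_Icc.1 hj).2
    omega
  have e₁ : {ω' | H ω' = i ∧ ∀ j ∈ Finset.Icc 1 k, Z j ω' = if j = k + 1 then z' else Z j ω} =
      {ω | H ω = i} ∩ pathCylinder Z k ω := by
    ext ω'
    refine and_congr_right fun _ => forall₂_congr fun j hj => ?_
    rw [if_neg (hlt j hj)]
  have e₂ : {ω' | H ω' = i ∧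
      ∀ j ∈ Finset.Icc 1 (k + 1), Z j ω' = if j = k + 1 then z' else Z j ω} =
      {ω | H ω = i} ∩ (pathCylinder Z k ω ∩ {ω' | Z (k + 1) ω' = z'}) := by
    ext ω'
    refine and_congr_right fun _ => ⟨fun h => ⟨fun j hj => ?_, ?_⟩, fun h j hj => ?_⟩
    · have := h j (Finset.Icc_subset_Icc_right (Nat.le_succ k) hj)
      rwa [if_neg (hlt j hj)] at this
    · simpa using h (k + 1) (Finset.mem_Icc.2 ⟨by omega, le_rfl⟩)
    · split_ifs with he
      · exact he ▸ h.2
      · exact h.1 j (Finset.mem_Icc.2 ⟨(Finset.mem_Icc.1 hj).1, by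
          have := (Finset.mem_Icc.1 hj).2; omega⟩)
  rwa [e₁, e₂, if_pos rfl, if_neg (by omega)] at this

variable [IsProbabilityMeasure P]

lemma posterior_mem_Icc (hZ : ∀ k, Measurable (Z k)) (k : ℕ) (ω : Ω) :
    posterior P H Z k ω ∈ Set.Icc (0 : ℝ) 1 := by
  rw [posterior_eq_div hZ]
  exact ⟨by positivity, div_le_one_of_le₀ (measureReal_mono Set.inter_subset_right)
    measureReal_nonneg⟩

lemma posterior_mul_real (hZ : ∀ k, Measurable (Z k)) (k : ℕ) (ω : Ω) :
    posterior P H Z k ω * P.real (pathCylinder Z k ω) =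
      P.real ({ω | H ω = 1} ∩ pathCylinder Z k ω) := by
  rw [posterior_eq_div hZ]
  rcases eq_or_ne (P.real (pathCylinder Z k ω)) 0 with h | h
  · rw [h, mul_zero]
    exact le_antisymm measureReal_nonneg (h ▸ measureReal_mono Set.inter_subset_right)
  · exact div_mul_cancel₀ _ h

lemma real_hypothesis_inter_add (hH : Measurable H) (B : Set Ω) :
    P.real ({ω | H ω = 1} ∩ B) + P.real ({ω | H ω = 0} ∩ B) = P.real B := by
  have h0 : {ω | H ω = 0} = {ω | H ω = 1}ᶜ := by
    ext ω
    simp only [Set.mem_ofPred_eq, Set.mem_compl_iff]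
    omega
  rw [h0, Set.inter_comm, Set.inter_comm _ B]
  exact measureReal_inter_add_sdiff (hH (measurableSet_singleton 1))

lemma one_sub_posterior_mul_real (hZ : ∀ k, Measurable (Z k)) (hH : Measurable H) (k : ℕ)
    (ω : Ω) : (1 - posterior P H Z k ω) * P.real (pathCylinder Z k ω) =
      P.real ({ω | H ω = 0} ∩ pathCylinder Z k ω) := by
  rw [sub_mul, posterior_mul_real hZ, one_mul,
    ← real_hypothesis_inter_add (P := P) hH (pathCylinder Z k ω)]
  ring

lemma setLIntegral_posterior (hZ : ∀ k, Measurable (Z k)) (hH : Measurable H) {k : ℕ} {A : Set Ω}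
    (hA : MeasurableSet[obsFiltration Z hZ k] A) :
    ∫⁻ ω in A, ENNReal.ofReal (posterior P H Z k ω) ∂P = P ({ω | H ω = 1} ∩ A) := by
  have h1 : MeasurableSet {ω | H ω = 1} := hH (measurableSet_singleton 1)
  rw [← one_mul (P _), ← setLIntegral_indicator_const h1]
  refine setLIntegral_eq_of_forall_pathCylinder hZ hA fun ω _ => ?_
  rw [setLIntegral_indicator_const h1, setLIntegral_pathCylinder_of_forall_mem hZ
    fun ω' h => by rw [posterior_eq_of_mem h], one_mul, ← ofReal_measureReal,
    ← ofReal_measureReal, ← ENNReal.ofReal_mul (posterior_mem_Icc hZ k ω).1,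
    posterior_mul_real hZ]

lemma setLIntegral_one_sub_posterior (hZ : ∀ k, Measurable (Z k)) (hH : Measurable H) {k : ℕ}
    {A : Set Ω} (hA : MeasurableSet[obsFiltration Z hZ k] A) :
    ∫⁻ ω in A, ENNReal.ofReal (1 - posterior P H Z k ω) ∂P = P ({ω | H ω = 0} ∩ A) := by
  have h0 : MeasurableSet {ω | H ω = 0} := hH (measurableSet_singleton 0)
  rw [← one_mul (P _), ← setLIntegral_indicator_const h0]
  refine setLIntegral_eq_of_forall_pathCylinder hZ hA fun ω _ => ?_
  rw [setLIntegral_indicator_const h0, setLIntegral_pathCylinder_of_forall_mem hZ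
    fun ω' h => by rw [posterior_eq_of_mem h], one_mul, ← ofReal_measureReal,
    ← ofReal_measureReal, ← ENNReal.ofReal_mul (sub_nonneg.2 (posterior_mem_Icc hZ k ω).2),
    one_sub_posterior_mul_real hZ hH]

section Markov

variable {π₁ : ℝ} {α : Fin 2 → Fin 4 → Fin 4 → ℝ}

lemma IsObservationModel.real_next (hZ : ∀ k, Measurable (Z k))
    (hM : IsObservationModel P π₁ α H Z) {k : ℕ} (hk : 1 ≤ k) (z' : Fin 4) (ω : Ω) :
    P.real (pathCylinder Z k ω ∩ {ω' | Z (k + 1) ω' = z'}) =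
      nextProb α (Z k ω) z' (posterior P H Z k ω) * P.real (pathCylinder Z k ω) := by
  rw [← real_hypothesis_inter_add hM.measurable_hypothesis,
    hM.real_hypothesis_inter_next hk, hM.real_hypothesis_inter_next hk,
    ← posterior_mul_real hZ, ← one_sub_posterior_mul_real hZ hM.measurable_hypothesis, nextProb]
  ring

lemma IsObservationModel.posterior_succ (hZ : ∀ k, Measurable (Z k))
    (hM : IsObservationModel P π₁ α H Z) {k : ℕ} (hk : 1 ≤ k) (ω : Ω) :
    posterior P H Z (k + 1) ω =
      nextBelief α (Z k ω) (Z (k + 1) ω) (posterior P H Z k ω) := by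
  rw [posterior_eq_div hZ, pathCylinder_succ, hM.real_hypothesis_inter_next hk,
    hM.real_next hZ hk, nextBelief, ← posterior_mul_real hZ]
  rcases eq_or_ne (P.real (pathCylinder Z k ω)) 0 with h | h
  -- On a null cylinder the posterior has the default value `0`, which Bayes' rule preserves.
  · have : posterior P H Z k ω = 0 := by rw [posterior_eq_div hZ, h, div_zero]
    simp [this]
  · rw [mul_right_comm, mul_div_mul_right _ _ h]

/-- The conditional expectation of a function of the next edge type and the next posterior. -/
lemma IsObservationModel.setLIntegral_next (hα : IsTransitionFamily α)
    (hZ : ∀ k, Measurable (Z k)) (hM : IsObservationModel P π₁ α H Z) {k : ℕ} (hk : 1 ≤ k)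
    {s : Fin 4 → ℝ → ℝ} (hs : ∀ z, ∀ π ∈ Set.Icc (0 : ℝ) 1, 0 ≤ s z π) (ω : Ω) :
    ∫⁻ x in pathCylinder Z k ω, ENNReal.ofReal (s (Z (k + 1) x) (posterior P H Z (k + 1) x)) ∂P =
      ENNReal.ofReal (∑ z', s z' (nextBelief α (Z k ω) z' (posterior P H Z k ω)) *
        nextProb α (Z k ω) z' (posterior P H Z k ω)) * P (pathCylinder Z k ω) := by
  have hπ := posterior_mem_Icc (P := P) (H := H) hZ k ω
  have hm : ∀ z', MeasurableSet (pathCylinder Z k ω ∩ {ω' | Z (k + 1) ω' = z'}) := fun z' =>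
    (measurableSet_pathCylinder hZ k ω).inter (hZ _ (measurableSet_singleton z'))
  have hU : pathCylinder Z k ω =
      ⋃ z' ∈ (Finset.univ : Finset (Fin 4)), pathCylinder Z k ω ∩ {ω' | Z (k + 1) ω' = z'} := by
    ext ω'; simp
  conv_lhs => rw [hU]
  rw [lintegral_biUnion_finset (fun x _ y _ hxy => Set.disjoint_left.2 fun ω' h h' =>
    hxy (h.2.symm.trans h'.2)) fun z' _ => hm z', ENNReal.ofReal_sum_of_nonneg fun z' _ =>
    mul_nonneg (hs _ _ (nextBelief_mem_Icc hα hπ)) (nextProb_nonneg hα hπ), Finset.sum_mul]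
  refine Finset.sum_congr rfl fun z' _ => ?_
  have hcongr : ∀ x ∈ pathCylinder Z k ω ∩ {ω' | Z (k + 1) ω' = z'},
      ENNReal.ofReal (s (Z (k + 1) x) (posterior P H Z (k + 1) x)) =
        ENNReal.ofReal (s z' (nextBelief α (Z k ω) z' (posterior P H Z k ω))) := by
    intro x hx
    rw [hM.posterior_succ hZ hk, posterior_eq_of_mem hx.1, hx.1 k (Finset.mem_Icc.2 ⟨hk, le_rfl⟩),
      hx.2]
  rw [setLIntegral_congr_fun (hm z') hcongr, setLIntegral_const, ← ofReal_measureReal,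
    ← ofReal_measureReal, hM.real_next hZ hk,
    ENNReal.ofReal_mul (hs _ _ (nextBelief_mem_Icc hα hπ)),
    ENNReal.ofReal_mul (nextProb_nonneg hα hπ), mul_assoc]

/-- On a cylinder, charging `c` on `H = 1` costs on average `c` times the posterior. This identifies
the Bellman continuation cost with a one-step conditional expectation. -/
lemma IsObservationModel.setLIntegral_continue (hα : IsTransitionFamily α)
    (hZ : ∀ k, Measurable (Z k)) (hM : IsObservationModel P π₁ α H Z) {k : ℕ} (hk : 1 ≤ k) {c : ℝ}
    (hc : 0 < c) {s : Fin 4 → ℝ → ℝ} (hs : ∀ z, ∀ π ∈ Set.Icc (0 : ℝ) 1, 0 ≤ s z π) (ω : Ω) :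
    ∫⁻ x in pathCylinder Z k ω, {ω | H ω = 1}.indicator (fun _ => ENNReal.ofReal c) x +
        ENNReal.ofReal (s (Z (k + 1) x) (posterior P H Z (k + 1) x)) ∂P =
      ENNReal.ofReal (continuationCost α c s (Z k ω) (posterior P H Z k ω)) *
        P (pathCylinder Z k ω) := by
  have h1 : MeasurableSet {ω | H ω = 1} := hM.measurable_hypothesis (measurableSet_singleton 1)
  have hπ := posterior_mem_Icc (P := P) (H := H) hZ k ω
  rw [lintegral_add_left (measurable_const.indicator h1), setLIntegral_indicator_const h1,
    hM.setLIntegral_next hα hZ hk hs, continuationCost, ENNReal.ofReal_add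
      (Finset.sum_nonneg fun z' _ =>
        mul_nonneg (hs _ _ (nextBelief_mem_Icc hα hπ)) (nextProb_nonneg hα hπ))
      (mul_nonneg hc.le hπ.1), add_mul, add_comm, ENNReal.ofReal_mul hc.le, mul_assoc]
  congr 2
  rw [← ofReal_measureReal, ← ofReal_measureReal, ← posterior_mul_real hZ,
    ENNReal.ofReal_mul hπ.1]

end Markov

/-- Lévy's zero-one law for the posterior. -/
lemma setLIntegral_limsup_posterior (hZ : ∀ k, Measurable (Z k)) (hH : Measurable H) {A : Set Ω}
    (hA : MeasurableSet[⨆ k, obsFiltration Z hZ k] A) :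
    ∫⁻ ω in A, ENNReal.ofReal (Filter.limsup (fun k : ℕ => posterior P H Z k ω) Filter.atTop) ∂P =
      P ({ω | H ω = 1} ∩ A) := by
  have h1 : MeasurableSet {ω | H ω = 1} := hH (measurableSet_singleton 1)
  have hle : ⨆ k, obsFiltration Z hZ k ≤ (inferInstance : MeasurableSpace Ω) :=
    iSup_le fun k => (obsFiltration Z hZ).le k
  set h : Ω → ℝ := {ω | H ω = 1}.indicator fun _ => 1
  have hint : Integrable h P := (integrable_const 1).indicator h1
  have hset : ∀ B, MeasurableSet B → ∫ x in B, h x ∂P = P.real ({ω | H ω = 1} ∩ B) := by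
    intro B _
    rw [integral_indicator h1, setIntegral_const, smul_eq_mul, mul_one,
      measureReal_restrict_apply h1]
  have hpint : ∀ k, Integrable (posterior P H Z k) P := fun k =>
    Integrable.of_bound (C := 1)
      ((measurable_posterior hZ k).mono ((obsFiltration Z hZ).le k) le_rfl).aestronglyMeasurable
      (Filter.Eventually.of_forall fun ω => by
        rw [Real.norm_of_nonneg (posterior_mem_Icc hZ k ω).1]; exact (posterior_mem_Icc hZ k ω).2)
  -- The elementary posterior is a version of the conditional expectation of the indicator of `H =
  -- 1`, so Lévy's upward theorem applies.
  have hk : ∀ k, posterior P H Z k =ᵐ[P] P[h | obsFiltration Z hZ k] := by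
    intro k
    refine ae_eq_condExp_of_forall_setIntegral_eq ((obsFiltration Z hZ).le k) hint
      (fun B _ _ => (hpint k).integrableOn) (fun B hB _ => ?_)
      (measurable_posterior hZ k).stronglyMeasurable.aestronglyMeasurable
    rw [hset B ((obsFiltration Z hZ).le k B hB), integral_eq_lintegral_of_nonneg_ae
      (Filter.Eventually.of_forall fun ω => (posterior_mem_Icc hZ k ω).1)
      (hpint k).aestronglyMeasurable.restrict, setLIntegral_posterior hZ hH hB]
    rfl
  have hlim : (fun ω => Filter.limsup (fun k : ℕ => posterior P H Z k ω) Filter.atTop) =ᵐ[P]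
      P[h | ⨆ k, obsFiltration Z hZ k] := by
    filter_upwards [tendsto_ae_condExp (ℱ := obsFiltration Z hZ) (μ := P) h, ae_all_iff.2 hk]
      with ω hω hω'
    simp only [hω']
    exact hω.limsup_eq
  have hpos : 0 ≤ᵐ[P] P[h | ⨆ k, obsFiltration Z hZ k] :=
    condExp_nonneg (Filter.Eventually.of_forall fun ω => Set.indicator_nonneg
      (fun _ _ => zero_le_one) ω)
  have hofReal := ae_restrict_of_ae (s := A) (hlim.fun_comp ENNReal.ofReal)
  refine (lintegral_congr_ae hofReal).trans ?_
  change ∫⁻ ω in A, ENNReal.ofReal ((P[h | ⨆ k, obsFiltration Z hZ k]) ω) ∂P = _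
  rw [← ofReal_integral_eq_lintegral_ofReal integrable_condExp.integrableOn
    (ae_restrict_of_ae hpos),
    setIntegral_condExp hle hint hA, hset A (hle A hA), ofReal_measureReal]

end Posterior

/-! ### Verification: comparing the loss of a time with the Bellman value. -/

section StoppedLoss

variable {Ω : Type*} [MeasurableSpace Ω] {P : Measure Ω} {H : Ω → Fin 2} {Z : ℕ → Ω → Fin 4}

lemma lintegral_eq_top_add_tsum {T : Ω → ℕ∞} (hT : ∀ k : ℕ, MeasurableSet {ω | T ω = k})
    (f : Ω → ℝ≥0∞) :
    ∫⁻ ω, f ω ∂P = ∫⁻ ω in {ω | T ω = ⊤}, f ω ∂P + ∑' k : ℕ, ∫⁻ ω in {ω | T ω = k}, f ω ∂P := by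
  have hU : {ω | T ω = ⊤}ᶜ = ⋃ k : ℕ, {ω | T ω = k} := by
    ext ω
    simp only [Set.mem_compl_iff, Set.mem_ofPred_eq, Set.mem_iUnion]
    exact ENat.ne_top_iff_exists.trans (exists_congr fun _ => eq_comm)
  have hm : MeasurableSet {ω | T ω = ⊤} := by
    rw [← MeasurableSet.compl_iff, hU]
    exact MeasurableSet.iUnion hT
  rw [← lintegral_add_compl f hm, hU, lintegral_iUnion hT fun i j hij =>
    Set.disjoint_left.2 fun ω (h : T ω = i) (h' : T ω = j) =>
      hij (by exact_mod_cast h.symm.trans h')]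

lemma ENat.toENNReal_eq_tsum (t : ℕ∞) :
    (t : ℝ≥0∞) = ∑' k : ℕ, if (k : ℕ∞) < t then 1 else 0 := by
  induction t using ENat.recTopCoe with
  | top => simp
  | coe n =>
    rw [tsum_eq_sum (s := Finset.range n) fun k hk => if_neg (by simpa using hk)]
    rw [Finset.sum_congr rfl fun k hk => if_pos (by simpa using hk)]
    simp

lemma lintegral_indicator_mul_eq_tsum (hH : Measurable H) {T : Ω → ℕ∞}
    (hT : ∀ k : ℕ, MeasurableSet {ω | (k : ℕ∞) < T ω}) (a : ℝ≥0∞) :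
    ∫⁻ ω, {ω | H ω = 1}.indicator (fun ω => a * (T ω : ℝ≥0∞)) ω ∂P =
      ∑' k : ℕ, a * P ({ω | H ω = 1} ∩ {ω | (k : ℕ∞) < T ω}) := by
  have h1 : MeasurableSet {ω | H ω = 1} := hH (measurableSet_singleton 1)
  have hf : ∀ ω, {ω | H ω = 1}.indicator (fun ω => a * (T ω : ℝ≥0∞)) ω =
      ∑' k : ℕ, ({ω | H ω = 1} ∩ {ω | (k : ℕ∞) < T ω}).indicator (fun _ => a) ω := by
    intro ω
    by_cases h : H ω = 1
    · rw [Set.indicator_of_mem (by exact h), ENat.toENNReal_eq_tsum, ← ENNReal.tsum_mul_left]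
      refine tsum_congr fun k => ?_
      by_cases hk : (k : ℕ∞) < T ω
      · rw [if_pos hk, Set.indicator_of_mem (by exact ⟨h, hk⟩), mul_one]
      · rw [if_neg hk, Set.indicator_of_notMem (fun h' => hk h'.2), mul_zero]
    · rw [Set.indicator_of_notMem (by exact h)]
      symm
      exact ENNReal.tsum_eq_zero.2 fun k => Set.indicator_of_notMem (fun h' => h h'.1) _
  simp only [hf]
  rw [lintegral_tsum fun k => (measurable_const.indicator (h1.inter (hT k))).aemeasurable]
  exact tsum_congr fun k => by rw [lintegral_indicator (h1.inter (hT k)), setLIntegral_const]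

/-- The expected loss of stopping at `T`, as a series over time: the cost `c` is paid at time `k`
when `H = 1` and `k < T`, and the error cost of the better declaration at time `k = T`. -/
noncomputable def stoppedLoss (P : Measure Ω) (H : Ω → Fin 2) (Z : ℕ → Ω → Fin 4) (c cI cII : ℝ)
    (T : Ω → ℕ∞) : ℝ≥0∞ :=
  ∑' k : ℕ, (ENNReal.ofReal c * P ({ω | H ω = 1} ∩ {ω | (k : ℕ∞) < T ω}) +
    ∫⁻ ω in {ω | T ω = k}, ENNReal.ofReal (errorCost cI cII (posterior P H Z k ω)) ∂P)

/-- The expected loss up to time `n` when the values `s` are paid at time `min T n`. -/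
noncomputable def truncatedLoss (P : Measure Ω) (H : Ω → Fin 2) (Z : ℕ → Ω → Fin 4) (c : ℝ)
    (s : Fin 4 → ℝ → ℝ) (T : Ω → ℕ∞) (n : ℕ) : ℝ≥0∞ :=
  ∑ k ∈ Finset.range n, ENNReal.ofReal c * P ({ω | H ω = 1} ∩ {ω | (k : ℕ∞) < T ω}) +
    ∑ k ∈ Finset.range (n + 1),
      ∫⁻ ω in {ω | T ω = k}, ENNReal.ofReal (s (Z k ω) (posterior P H Z k ω)) ∂P +
    ∫⁻ ω in {ω | (n : ℕ∞) < T ω}, ENNReal.ofReal (s (Z n ω) (posterior P H Z n ω)) ∂P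

/-- The value of the problem before the first observation. -/
noncomputable def initialValue (P : Measure Ω) (H : Ω → Fin 2) (Z : ℕ → Ω → Fin 4) (c : ℝ)
    (s : Fin 4 → ℝ → ℝ) : ℝ≥0∞ :=
  ENNReal.ofReal c * P {ω | H ω = 1} +
    ∫⁻ ω, ENNReal.ofReal (s (Z 1 ω) (posterior P H Z 1 ω)) ∂P

lemma lintegral_lt_eq_add {T : Ω → ℕ∞} (hT : ∀ k : ℕ, MeasurableSet {ω | (k : ℕ∞) < T ω}) (n : ℕ)
    (f : Ω → ℝ≥0∞) :
    ∫⁻ ω in {ω | (n : ℕ∞) < T ω}, f ω ∂P = ∫⁻ ω in {ω | T ω = (n + 1 : ℕ)}, f ω ∂P +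
      ∫⁻ ω in {ω | ((n + 1 : ℕ) : ℕ∞) < T ω}, f ω ∂P := by
  have hd : Disjoint {ω | T ω = (n + 1 : ℕ)} {ω | ((n + 1 : ℕ) : ℕ∞) < T ω} :=
    Set.disjoint_left.2 fun ω (h : T ω = _) (h' : _ < T ω) => h'.ne' h
  rw [← lintegral_union (hT (n + 1)) hd]
  congr 2
  ext ω
  simp only [Set.mem_union, Set.mem_ofPred_eq]
  rw [← ENat.add_one_le_iff (ENat.natCast_ne_top n), le_iff_eq_or_lt, eq_comm]
  push_cast
  rfl

/-- As `T ≥ 1`, the first observation is compulsory: its cost is always paid, and the comparison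
starts at time `1` with a value independent of `T`. -/
lemma truncatedLoss_one {T : Ω → ℕ∞} (hT : ∀ k : ℕ, MeasurableSet {ω | (k : ℕ∞) < T ω})
    (h1 : ∀ ω, 1 ≤ T ω) (c : ℝ) (s : Fin 4 → ℝ → ℝ) :
    truncatedLoss P H Z c s T 1 = initialValue P H Z c s := by
  have e0 : {ω | T ω = (0 : ℕ)} = ∅ := Set.eq_empty_iff_forall_notMem.2 fun ω (h : T ω = _) => by
    have := h1 ω
    rw [h] at this
    exact absurd this (by decide)
  have e1 : {ω | ((0 : ℕ) : ℕ∞) < T ω} = Set.univ := Set.eq_univ_iff_forall.2 fun ω =>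
    lt_of_lt_of_le (by decide) (h1 ω)
  have := lintegral_lt_eq_add (P := P) hT 0
    fun ω => ENNReal.ofReal (s (Z 1 ω) (posterior P H Z 1 ω))
  rw [e1, Measure.restrict_univ] at this
  rw [truncatedLoss, initialValue, this]
  simp only [Finset.sum_range_succ, Finset.range_zero, Finset.sum_empty, zero_add, e0, e1,
    Set.inter_univ, Measure.restrict_empty, lintegral_zero_measure, add_assoc]

lemma truncatedLoss_succ {c : ℝ} {s : Fin 4 → ℝ → ℝ} {T : Ω → ℕ∞}
    (hT : ∀ k : ℕ, MeasurableSet {ω | (k : ℕ∞) < T ω}) (n : ℕ) :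
    truncatedLoss P H Z c s T (n + 1) =
      (∑ k ∈ Finset.range n, ENNReal.ofReal c * P ({ω | H ω = 1} ∩ {ω | (k : ℕ∞) < T ω}) +
      ∑ k ∈ Finset.range (n + 1),
        ∫⁻ ω in {ω | T ω = k}, ENNReal.ofReal (s (Z k ω) (posterior P H Z k ω)) ∂P) +
      (ENNReal.ofReal c * P ({ω | H ω = 1} ∩ {ω | (n : ℕ∞) < T ω}) +
        ∫⁻ ω in {ω | (n : ℕ∞) < T ω},
          ENNReal.ofReal (s (Z (n + 1) ω) (posterior P H Z (n + 1) ω)) ∂P) := by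
  rw [lintegral_lt_eq_add hT n, truncatedLoss, Finset.sum_range_succ _ n,
    Finset.sum_range_succ _ (n + 1)]
  ring

/-- Finite loss makes these probabilities summable. This removes the remainder in the lower bound
and later yields `T* < ∞`. -/
lemma tendsto_measure_lt_of_stoppedLoss_ne_top {c cI cII : ℝ} {T : Ω → ℕ∞} (hc : 0 < c)
    (h : stoppedLoss P H Z c cI cII T ≠ ⊤) :
    Filter.Tendsto (fun n : ℕ => P ({ω | H ω = 1} ∩ {ω | (n : ℕ∞) < T ω})) Filter.atTop
      (nhds 0) := by
  rw [stoppedLoss, ENNReal.tsum_add, ENNReal.add_ne_top, ENNReal.tsum_mul_left] at h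
  refine ENNReal.tendsto_atTop_zero_of_tsum_ne_top fun htop => h.1 ?_
  rw [htop, ENNReal.mul_top (ENNReal.ofReal_pos.2 hc).ne']

variable [IsProbabilityMeasure P] {π₁ c cI cII : ℝ} {α : Fin 2 → Fin 4 → Fin 4 → ℝ}
  {s : Fin 4 → ℝ → ℝ}

/-- The submartingale inequality, from `s ≤ continuationCost` on each cylinder; equality holds where
continuing is strictly better. -/
lemma IsBellmanSolution.setLIntegral_le (hα : IsTransitionFamily α)
    (hs : IsBellmanSolution α c cI cII s) (hc : 0 < c) (hZ : ∀ k, Measurable (Z k))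
    (hM : IsObservationModel P π₁ α H Z) {k : ℕ} (hk : 1 ≤ k) {A : Set Ω}
    (hA : MeasurableSet[obsFiltration Z hZ k] A) :
    ∫⁻ ω in A, ENNReal.ofReal (s (Z k ω) (posterior P H Z k ω)) ∂P ≤
      ENNReal.ofReal c * P ({ω | H ω = 1} ∩ A) +
        ∫⁻ ω in A, ENNReal.ofReal (s (Z (k + 1) ω) (posterior P H Z (k + 1) ω)) ∂P := by
  have h1 : MeasurableSet {ω | H ω = 1} := hM.measurable_hypothesis (measurableSet_singleton 1)
  rw [← setLIntegral_indicator_const h1, ← lintegral_add_left (measurable_const.indicator h1)]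
  refine setLIntegral_le_of_forall_pathCylinder hZ hA fun ω _ => ?_
  rw [hM.setLIntegral_continue hα hZ hk hc hs.nonneg, setLIntegral_pathCylinder_of_forall_mem hZ
    fun ω' h => by rw [posterior_eq_of_mem h, h k (Finset.mem_Icc.2 ⟨hk, le_rfl⟩)]]
  gcongr
  exact hs.le_continuationCost _ (posterior_mem_Icc hZ k ω)

lemma IsBellmanSolution.setLIntegral_eq (hα : IsTransitionFamily α)
    (hs : IsBellmanSolution α c cI cII s) (hc : 0 < c) (hZ : ∀ k, Measurable (Z k))
    (hM : IsObservationModel P π₁ α H Z) {k : ℕ} (hk : 1 ≤ k) {A : Set Ω}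
    (hA : MeasurableSet[obsFiltration Z hZ k] A)
    (hlt : ∀ ω ∈ A, s (Z k ω) (posterior P H Z k ω) < errorCost cI cII (posterior P H Z k ω)) :
    ∫⁻ ω in A, ENNReal.ofReal (s (Z k ω) (posterior P H Z k ω)) ∂P =
      ENNReal.ofReal c * P ({ω | H ω = 1} ∩ A) +
        ∫⁻ ω in A, ENNReal.ofReal (s (Z (k + 1) ω) (posterior P H Z (k + 1) ω)) ∂P := by
  have h1 : MeasurableSet {ω | H ω = 1} := hM.measurable_hypothesis (measurableSet_singleton 1)
  rw [← setLIntegral_indicator_const h1, ← lintegral_add_left (measurable_const.indicator h1)]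
  refine setLIntegral_eq_of_forall_pathCylinder hZ hA fun ω hω => ?_
  rw [hM.setLIntegral_continue hα hZ hk hc hs.nonneg, setLIntegral_pathCylinder_of_forall_mem hZ
    fun ω' h => by rw [posterior_eq_of_mem h, h k (Finset.mem_Icc.2 ⟨hk, le_rfl⟩)],
    hs.eq_continuationCost _ (posterior_mem_Icc hZ k ω) (hlt ω hω)]

section Admissible

variable (hα : IsTransitionFamily α) (hs : IsBellmanSolution α c cI cII s) (hc : 0 < c)
  (hZ : ∀ k, Measurable (Z k)) (hM : IsObservationModel P π₁ α H Z) {T : Ω → ℕ∞}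

lemma measurableSet_time_lt {hZ : ∀ k, Measurable (Z k)}
    (hT : IsStoppingTime (obsFiltration Z hZ) T) (k : ℕ) :
    MeasurableSet[obsFiltration Z hZ k] {ω | (k : ℕ∞) < T ω} :=
  hT.measurableSet_gt k

lemma measurableSet_time_eq {hZ : ∀ k, Measurable (Z k)}
    (hT : IsStoppingTime (obsFiltration Z hZ) T) (k : ℕ) :
    MeasurableSet[obsFiltration Z hZ k] {ω | T ω = k} :=
  hT.measurableSet_eq k

lemma measurableSet_time_lt' {hZ : ∀ k, Measurable (Z k)}
    (hT : IsStoppingTime (obsFiltration Z hZ) T) (k : ℕ) : MeasurableSet {ω | (k : ℕ∞) < T ω} :=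
  (obsFiltration Z hZ).le k _ (measurableSet_time_lt hT k)

lemma measurableSet_time_eq' {hZ : ∀ k, Measurable (Z k)}
    (hT : IsStoppingTime (obsFiltration Z hZ) T) (k : ℕ) : MeasurableSet {ω | T ω = k} :=
  (obsFiltration Z hZ).le k _ (measurableSet_time_eq hT k)

include hα hs hc hM in
lemma initialValue_le_truncatedLoss (hT : IsAdmissibleTime Z hZ T) {n : ℕ} (hn : 1 ≤ n) :
    initialValue P H Z c s ≤ truncatedLoss P H Z c s T n := by
  induction n, hn using Nat.le_induction with
  | base => exact (truncatedLoss_one (measurableSet_time_lt' hT.1) hT.2 c s).ge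
  | succ n hn ih =>
    refine ih.trans ?_
    rw [truncatedLoss_succ (measurableSet_time_lt' hT.1), truncatedLoss]
    gcongr
    exact hs.setLIntegral_le hα hc hZ hM hn (measurableSet_time_lt hT.1 n)

include hα hs hc hM in
lemma truncatedLoss_eq_initialValue (hT : IsAdmissibleTime Z hZ T)
    (hlt : ∀ ω, ∀ k : ℕ, 1 ≤ k → (k : ℕ∞) < T ω →
      s (Z k ω) (posterior P H Z k ω) < errorCost cI cII (posterior P H Z k ω))
    {n : ℕ} (hn : 1 ≤ n) : truncatedLoss P H Z c s T n = initialValue P H Z c s := by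
  induction n, hn using Nat.le_induction with
  | base => exact truncatedLoss_one (measurableSet_time_lt' hT.1) hT.2 c s
  | succ n hn ih =>
    rw [← ih, truncatedLoss_succ (measurableSet_time_lt' hT.1), truncatedLoss,
      hs.setLIntegral_eq hα hc hZ hM hn (measurableSet_time_lt hT.1 n) fun ω h => hlt ω n hn h]

include hα hs hc hM in
/-- No admissible time beats the Bellman value. -/
lemma initialValue_le_stoppedLoss (hT : IsAdmissibleTime Z hZ T) :
    initialValue P H Z c s ≤ stoppedLoss P H Z c cI cII T := by
  by_cases htop : stoppedLoss P H Z c cI cII T = ⊤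
  · exact htop ▸ le_top
  have hlim : Filter.Tendsto (fun n : ℕ => stoppedLoss P H Z c cI cII T +
      ENNReal.ofReal cII * P ({ω | H ω = 1} ∩ {ω | (n : ℕ∞) < T ω})) Filter.atTop
      (nhds (stoppedLoss P H Z c cI cII T + ENNReal.ofReal cII * 0)) :=
    (ENNReal.Tendsto.const_mul (tendsto_measure_lt_of_stoppedLoss_ne_top hc htop)
      (Or.inr ENNReal.ofReal_ne_top)).const_add _
  rw [mul_zero, add_zero] at hlim
  refine ge_of_tendsto hlim (Filter.eventually_atTop.2 ⟨1, fun n hn => ?_⟩)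
  refine (initialValue_le_truncatedLoss hα hs hc hZ hM hT hn).trans ?_
  rw [truncatedLoss]
  refine add_le_add ?_ ?_
  · rw [stoppedLoss, ENNReal.tsum_add]
    refine add_le_add (ENNReal.sum_le_tsum _) (le_trans (Finset.sum_le_sum fun k _ => ?_)
      (ENNReal.sum_le_tsum (Finset.range (n + 1))))
    exact lintegral_mono fun ω =>
      ENNReal.ofReal_le_ofReal (hs.le_errorCost _ (posterior_mem_Icc hZ k ω))
  · rw [← setLIntegral_posterior hZ hM.measurable_hypothesis (measurableSet_time_lt hT.1 n),
      ← lintegral_const_mul' _ _ ENNReal.ofReal_ne_top]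
    refine lintegral_mono fun ω => ?_
    have hπ := posterior_mem_Icc (P := P) (H := H) hZ n ω
    rw [← ENNReal.ofReal_mul' hπ.1]
    exact ENNReal.ofReal_le_ofReal (hs.le_mul _ hπ)

include hα hs hc hM in
/-- A time that continues only where continuing is strictly better, and stops only where stopping
is optimal, attains the Bellman value. -/
lemma stoppedLoss_le_initialValue (hT : IsAdmissibleTime Z hZ T)
    (hlt : ∀ ω, ∀ k : ℕ, 1 ≤ k → (k : ℕ∞) < T ω →
      s (Z k ω) (posterior P H Z k ω) < errorCost cI cII (posterior P H Z k ω))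
    (heq : ∀ ω, ∀ k : ℕ, T ω = k →
      s (Z k ω) (posterior P H Z k ω) = errorCost cI cII (posterior P H Z k ω)) :
    stoppedLoss P H Z c cI cII T ≤ initialValue P H Z c s := by
  -- Every partial sum is bounded by a truncated loss, whose remainder is nonnegative and can be
  -- dropped; no finiteness of `T` is needed.
  refine ENNReal.tsum_le_of_sum_range_le fun n => ?_
  refine (Finset.sum_le_sum_of_subset (Finset.range_mono (Nat.le_add_right n 1))).trans ?_
  rw [← truncatedLoss_eq_initialValue hα hs hc hZ hM hT hlt (n := n + 1) (by omega), truncatedLoss,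
    Finset.sum_add_distrib, Finset.sum_range_succ _ (n + 1), add_assoc]
  gcongr
  refine le_trans (Finset.sum_le_sum fun k _ => le_of_eq ?_)
    (le_self_add.trans le_self_add)
  exact setLIntegral_congr_fun (measurableSet_time_eq' hT.1 k) fun ω h =>
    congrArg ENNReal.ofReal (heq ω k h).symm

include hs in
lemma initialValue_ne_top (hZ : ∀ k, Measurable (Z k)) : initialValue P H Z c s ≠ ⊤ := by
  refine ENNReal.add_ne_top.2 ⟨ENNReal.mul_ne_top ENNReal.ofReal_ne_top (measure_ne_top _ _), ?_⟩
  refine ((lintegral_mono fun ω => ENNReal.ofReal_le_ofReal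
    ((hs.le_mul_one_sub (Z 1 ω) (posterior_mem_Icc hZ 1 ω)).trans ?_)).trans_lt
    -- The absolute value appears because no sign of `cI` is assumed here.
    (?_ : ∫⁻ _, ENNReal.ofReal |cI| ∂P < ⊤)).ne
  · have := posterior_mem_Icc (P := P) (H := H) hZ 1 ω
    refine (le_abs_self _).trans ?_
    rw [abs_mul, abs_of_nonneg (sub_nonneg.2 this.2)]
    exact mul_le_of_le_one_right (abs_nonneg _) (by linarith [this.1])
  · simp

end Admissible
end StoppedLoss

/-! ### Reduction of both costs to the stopped loss. -/

section Costs

variable {Ω : Type*} [MeasurableSpace Ω] {P : Measure Ω} {H : Ω → Fin 2} {Z : ℕ → Ω → Fin 4}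
  {T : Ω → ℕ∞} {π₁ c cI cII : ℝ}

lemma measurableSet_time_eq_top {hZ : ∀ k, Measurable (Z k)}
    (hT : IsStoppingTime (obsFiltration Z hZ) T) :
    MeasurableSet[⨆ k, obsFiltration Z hZ k] {ω | T ω = ⊤} := by
  have hU : {ω | T ω = ⊤}ᶜ = ⋃ k : ℕ, {ω | T ω = k} := by
    ext ω
    simp only [Set.mem_compl_iff, Set.mem_ofPred_eq, Set.mem_iUnion]
    exact ENat.ne_top_iff_exists.trans (exists_congr fun _ => eq_comm)
  rw [← @MeasurableSet.compl_iff _ _ (_), hU]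
  exact @MeasurableSet.iUnion _ _ (_) _ _ fun k =>
    le_iSup (fun k => (obsFiltration Z hZ k : MeasurableSpace Ω)) k _ (measurableSet_time_eq hT k)

lemma stoppedLoss_eq_tsum_add_lintegral (hZ : ∀ k, Measurable (Z k)) (hH : Measurable H)
    (hT : IsStoppingTime (obsFiltration Z hZ) T) :
    stoppedLoss P H Z c cI cII T =
      ∑' k : ℕ, ∫⁻ ω in {ω | T ω = k}, ENNReal.ofReal (errorCost cI cII (posterior P H Z k ω)) ∂P +
      ∫⁻ ω, {ω | H ω = 1}.indicator (fun ω => ENNReal.ofReal c * (T ω : ℝ≥0∞)) ω ∂P := by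
  rw [stoppedLoss, ENNReal.tsum_add, add_comm,
    lintegral_indicator_mul_eq_tsum hH (measurableSet_time_lt' hT)]

lemma measure_inter_ne_top_eq_tsum {hZ : ∀ k, Measurable (Z k)} {δ : Ω → Fin 2} (i j : Fin 2)
    (hH : Measurable H)
    (hδ : ∀ k : ℕ, MeasurableSet[obsFiltration Z hZ k] ({ω | δ ω = j} ∩ {ω | T ω = k})) :
    P ({ω | H ω = i} ∩ {ω | T ω ≠ ⊤ ∧ δ ω = j}) =
      ∑' k : ℕ, P ({ω | H ω = i} ∩ ({ω | δ ω = j} ∩ {ω | T ω = k})) := by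
  have hm : ∀ k : ℕ, MeasurableSet ({ω | H ω = i} ∩ ({ω | δ ω = j} ∩ {ω | T ω = k})) := fun k =>
    (hH (measurableSet_singleton i)).inter ((obsFiltration Z hZ).le k _ (hδ k))
  rw [← measure_iUnion (fun k l hkl => Set.disjoint_left.2 fun ω h h' =>
    hkl (by exact_mod_cast (h.2.2.symm.trans h'.2.2 : ((k : ℕ) : ℕ∞) = (l : ℕ)))) hm]
  congr 1
  ext ω
  simp only [Set.mem_inter_iff, Set.mem_ofPred_eq, Set.mem_iUnion, ENat.ne_top_iff_exists]
  constructor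
  · rintro ⟨h, ⟨k, hk⟩, h'⟩
    exact ⟨k, h, h', hk.symm⟩
  · rintro ⟨k, h, h', hk⟩
    exact ⟨h, ⟨k, hk.symm⟩, h'⟩

variable [IsProbabilityMeasure P]

/-- The cost of a time, with the posterior in place of the hypothesis, is its expected loss. The
two agree also where `T = ∞`: there both are infinite, unless `H = 1` has probability zero. -/
lemma stoppingCost_eq_stoppedLoss (hc : 0 < c) (hcII : 0 < cII) (hZ : ∀ k, Measurable (Z k))
    (hH : Measurable H) (hT : IsStoppingTime (obsFiltration Z hZ) T) :
    stoppingCost P H Z c cI cII T = stoppedLoss P H Z c cI cII T := by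
  have h1 : MeasurableSet {ω | H ω = 1} := hH (measurableSet_singleton 1)
  have hmt : MeasurableSet {ω | T ω = ⊤} :=
    (iSup_le (obsFiltration Z hZ).le : ⨆ k, obsFiltration Z hZ k ≤ (inferInstance :
      MeasurableSpace Ω)) _ (measurableSet_time_eq_top hT)
  have hmp : ∀ k, Measurable (posterior P H Z k) := fun k =>
    (measurable_posterior hZ k).mono ((obsFiltration Z hZ).le k) le_rfl
  rw [stoppedLoss_eq_tsum_add_lintegral hZ hH hT, stoppingCost,
    lintegral_eq_top_add_tsum (measurableSet_time_eq' hT),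
    lintegral_eq_top_add_tsum (measurableSet_time_eq' hT) (Set.indicator _ _), add_left_comm,
    ← ENNReal.tsum_add]
  congr 1
  · have htop : ∫⁻ ω in {ω | T ω = ⊤}, {ω | H ω = 1}.indicator
        (fun ω => ENNReal.ofReal c * (T ω : ℝ≥0∞)) ω ∂P =
        ENNReal.ofReal c * ⊤ * P ({ω | H ω = 1} ∩ {ω | T ω = ⊤}) := by
      rw [← setLIntegral_indicator_const h1]
      refine setLIntegral_congr_fun hmt fun ω (hω : T ω = ⊤) => ?_
      by_cases h : H ω = 1
      · rw [Set.indicator_of_mem (by exact h), Set.indicator_of_mem (by exact h), hω,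
          ENat.toENNReal_top]
      · rw [Set.indicator_of_notMem (by exact h), Set.indicator_of_notMem (by exact h)]
    set L : Ω → ℝ := fun ω => Filter.limsup (fun k : ℕ => posterior P H Z k ω) Filter.atTop
    have hL : Measurable L := Measurable.limsup hmp
    have hlevy : ∫⁻ ω in {ω | T ω = ⊤}, ENNReal.ofReal (L ω) ∂P =
        P ({ω | H ω = 1} ∩ {ω | T ω = ⊤}) :=
      setLIntegral_limsup_posterior hZ hH (measurableSet_time_eq_top hT)
    have hcost : ∫⁻ ω in {ω | T ω = ⊤},
        (ENNReal.ofReal (errorCost cI cII (posteriorAt P H Z (T ω) ω)) +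
          ENNReal.ofReal c * (T ω : ℝ≥0∞) * ENNReal.ofReal (posteriorAt P H Z (T ω) ω)) ∂P =
        ∫⁻ ω in {ω | T ω = ⊤}, ENNReal.ofReal (errorCost cI cII (L ω)) ∂P +
          ENNReal.ofReal c * ⊤ * P ({ω | H ω = 1} ∩ {ω | T ω = ⊤}) := by
      rw [← hlevy, ← lintegral_const_mul _ hL.ennreal_ofReal,
        ← lintegral_add_right _ (hL.ennreal_ofReal.const_mul _)]
      refine setLIntegral_congr_fun hmt fun ω (hω : T ω = ⊤) => ?_
      simp only [hω, ENat.toENNReal_top]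
      rfl
    rw [htop, hcost]
    -- If this probability is zero, Lévy's law makes the limiting posterior integrate to `0` on `T =
    -- ∞`, hence also `g ≤ c_II π`. Otherwise both sides are infinite.
    by_cases h0 : P ({ω | H ω = 1} ∩ {ω | T ω = ⊤}) = 0
    · have hle : ∫⁻ ω in {ω | T ω = ⊤}, ENNReal.ofReal (errorCost cI cII (L ω)) ∂P ≤ 0 := by
        rw [← mul_zero (ENNReal.ofReal cII), ← h0, ← hlevy,
          ← lintegral_const_mul _ hL.ennreal_ofReal]
        refine lintegral_mono fun ω => ?_
        rw [← ENNReal.ofReal_mul hcII.le]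
        exact ENNReal.ofReal_le_ofReal (min_le_left _ _)
      rw [le_zero_iff.1 hle, zero_add]
    · rw [ENNReal.mul_top (ENNReal.ofReal_pos.2 hc).ne', ENNReal.top_mul h0, add_top]
  · refine tsum_congr fun k => ?_
    have hmk := measurableSet_time_eq' hT k
    have hind : ∫⁻ ω in {ω | T ω = k}, {ω | H ω = 1}.indicator
        (fun ω => ENNReal.ofReal c * (T ω : ℝ≥0∞)) ω ∂P =
        ENNReal.ofReal c * k * P ({ω | H ω = 1} ∩ {ω | T ω = k}) := by
      rw [← setLIntegral_indicator_const h1]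
      refine setLIntegral_congr_fun hmk fun ω (hω : T ω = k) => ?_
      by_cases h : H ω = 1
      · rw [Set.indicator_of_mem (by exact h), Set.indicator_of_mem (by exact h), hω,
          ENat.toENNReal_coe]
      · rw [Set.indicator_of_notMem (by exact h), Set.indicator_of_notMem (by exact h)]
    rw [hind, ← setLIntegral_posterior hZ hH (measurableSet_time_eq hT k),
      ← lintegral_const_mul _ (hmp k).ennreal_ofReal,
      ← lintegral_add_right _ ((hmp k).ennreal_ofReal.const_mul _)]
    refine setLIntegral_congr_fun hmk fun ω (hω : T ω = k) => ?_
    simp only [hω, ENat.toENNReal_coe]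
    rfl

/-- The error cost of a declaration, resolved by the time of declaration. -/
lemma detectionCost_eq (hcI : 0 < cI) (hcII : 0 < cII) (hZ : ∀ k, Measurable (Z k))
    (hH : Measurable H) (hprior : P.real {ω | H ω = 1} = π₁)
    {δ : Ω → Fin 2}
    (hδ : ∀ j, ∀ k : ℕ, MeasurableSet[obsFiltration Z hZ k] ({ω | δ ω = j} ∩ {ω | T ω = k})) :
    detectionCost P H π₁ c cI cII T δ =
      ∑' k : ℕ, ∫⁻ ω in {ω | T ω = k}, ENNReal.ofReal (if δ ω = 1 then
        cI * (1 - posterior P H Z k ω) else cII * posterior P H Z k ω) ∂P +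
      ∫⁻ ω, {ω | H ω = 1}.indicator (fun ω => ENNReal.ofReal c * (T ω : ℝ≥0∞)) ω ∂P := by
  have h1 : MeasurableSet {ω | H ω = 1} := hH (measurableSet_singleton 1)
  have h0 : MeasurableSet {ω | H ω = 0} := hH (measurableSet_singleton 0)
  have hp1 : ENNReal.ofReal π₁ = P {ω | H ω = 1} := by rw [← hprior, ofReal_measureReal]
  have hp0 : ENNReal.ofReal (1 - π₁) = P {ω | H ω = 0} := by
    have := real_hypothesis_inter_add (P := P) hH Set.univ
    simp only [Set.inter_univ, hprior, probReal_univ] at this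
    rw [← this, add_sub_cancel_left, ofReal_measureReal]
  -- Conditional probability times prior is the joint probability, even for a hypothesis of
  -- probability zero.
  rw [detectionCost, hp1, hp0, mul_assoc, mul_assoc, cond_mul_eq_inter h0, cond_mul_eq_inter h1,
    measure_inter_ne_top_eq_tsum 0 1 hH (hδ 1), measure_inter_ne_top_eq_tsum 1 0 hH (hδ 0),
    ← ENNReal.tsum_mul_left, ← ENNReal.tsum_mul_left, ← ENNReal.tsum_add]
  congr 1
  refine tsum_congr fun k => ?_
  have hm := fun j => (obsFiltration Z hZ).le k _ (hδ j k)
  have hU : {ω | T ω = k} = ({ω | δ ω = 1} ∩ {ω | T ω = k}) ∪ ({ω | δ ω = 0} ∩ {ω | T ω = k}) := by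
    ext ω
    simp only [Set.mem_union, Set.mem_inter_iff, Set.mem_ofPred_eq]
    have : δ ω = 1 ∨ δ ω = 0 := by omega
    tauto
  have hd : Disjoint ({ω | δ ω = 1} ∩ {ω | T ω = k}) ({ω | δ ω = 0} ∩ {ω | T ω = k}) :=
    Set.disjoint_left.2 fun ω h h' => absurd (h.1.symm.trans h'.1) (by decide)
  conv_rhs => rw [hU, lintegral_union (hm 0) hd]
  rw [← setLIntegral_one_sub_posterior hZ hH (hδ 1 k), ← setLIntegral_posterior hZ hH (hδ 0 k),
    ← lintegral_const_mul' _ _ ENNReal.ofReal_ne_top,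
    ← lintegral_const_mul' _ _ ENNReal.ofReal_ne_top]
  congr 1
  · refine setLIntegral_congr_fun (hm 1) fun ω h => ?_
    rw [if_pos (show δ ω = 1 from h.1), ENNReal.ofReal_mul hcI.le]
  · refine setLIntegral_congr_fun (hm 0) fun ω h => ?_
    have h' : δ ω ≠ 1 := by rw [show δ ω = 0 from h.1]; decide
    rw [if_neg h', ENNReal.ofReal_mul hcII.le]

lemma stoppedLoss_le_detectionCost (hcI : 0 < cI) (hcII : 0 < cII) (hZ : ∀ k, Measurable (Z k))
    (hH : Measurable H) (hprior : P.real {ω | H ω = 1} = π₁)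
    (hT : IsStoppingTime (obsFiltration Z hZ) T) {δ : Ω → Fin 2}
    (hδ : ∀ j, ∀ k : ℕ, MeasurableSet[obsFiltration Z hZ k] ({ω | δ ω = j} ∩ {ω | T ω = k})) :
    stoppedLoss P H Z c cI cII T ≤ detectionCost P H π₁ c cI cII T δ := by
  rw [detectionCost_eq hcI hcII hZ hH hprior hδ, stoppedLoss_eq_tsum_add_lintegral hZ hH hT]
  gcongr
  split_ifs
  · exact min_le_right _ _
  · exact min_le_left _ _

/-- The thresholds lie on either side of the point where the two error costs agree, so a declaration
following them attains the minimum in `g`. -/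
lemma detectionCost_eq_stoppedLoss (hcI : 0 < cI) (hcII : 0 < cII) (hZ : ∀ k, Measurable (Z k))
    (hH : Measurable H) (hprior : P.real {ω | H ω = 1} = π₁)
    (hT : IsStoppingTime (obsFiltration Z hZ) T) {δ : Ω → Fin 2}
    (hδ : ∀ j, ∀ k : ℕ, MeasurableSet[obsFiltration Z hZ k] ({ω | δ ω = j} ∩ {ω | T ω = k}))
    {πl πu : Fin 4 → ℝ} (hl : ∀ z, πl z ≤ cI / (cI + cII)) (hu : ∀ z, cI / (cI + cII) ≤ πu z)
    (hdecl : IsThresholdDeclaration P H Z πl πu T δ) :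
    detectionCost P H π₁ c cI cII T δ = stoppedLoss P H Z c cI cII T := by
  rw [detectionCost_eq hcI hcII hZ hH hprior hδ, stoppedLoss_eq_tsum_add_lintegral hZ hH hT]
  congr 1
  refine tsum_congr fun k => setLIntegral_congr_fun (measurableSet_time_eq' hT k) fun ω h => ?_
  rcases hdecl ω k h with ⟨hd, hπ⟩ | ⟨hd, hπ⟩
  · rw [if_neg (by rw [hd]; decide), errorCost_eq_left hcI hcII (hπ.trans (hl _))]
  · rw [if_pos hd, errorCost_eq_right hcI hcII ((hu _).trans hπ)]

end Costs

/-! ### The threshold time and its declaration. -/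

section ThresholdTime

variable {Ω : Type*} [MeasurableSpace Ω] {P : Measure Ω} {H : Ω → Fin 2} {Z : ℕ → Ω → Fin 4}
  {πl πu : Fin 4 → ℝ}

lemma thresholdTime_le_iff {k : ℕ} {ω : Ω} :
    thresholdTime P H Z πl πu ω ≤ k ↔
      ∃ j ≤ k, 1 ≤ j ∧ posterior P H Z j ω ∉ Set.Ioo (πl (Z j ω)) (πu (Z j ω)) := by
  refine ⟨fun h => ?_, fun ⟨j, hjk, hj, hp⟩ => (iInf₂_le_of_le j hj (iInf_le _ hp)).trans
    (by exact_mod_cast hjk)⟩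
  by_contra! hall
  have : ((k + 1 : ℕ) : ℕ∞) ≤ thresholdTime P H Z πl πu ω := by
    refine le_iInf fun j => le_iInf fun hj => le_iInf fun hp => ?_
    have : k + 1 ≤ j := by
      by_contra hjk
      exact hp (hall j (by omega) hj)
    exact_mod_cast this
  have := this.trans h
  norm_cast at this
  omega

lemma one_le_thresholdTime (ω : Ω) : 1 ≤ thresholdTime P H Z πl πu ω :=
  le_iInf fun j => le_iInf fun hj => le_iInf fun _ => by exact_mod_cast hj

lemma notMem_Ioo_of_thresholdTime_eq {k : ℕ} {ω : Ω} (h : thresholdTime P H Z πl πu ω = k) :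
    posterior P H Z k ω ∉ Set.Ioo (πl (Z k ω)) (πu (Z k ω)) := by
  obtain ⟨j, hjk, hj, hp⟩ := thresholdTime_le_iff.1 h.le
  have : thresholdTime P H Z πl πu ω ≤ j := thresholdTime_le_iff.2 ⟨j, le_rfl, hj, hp⟩
  rw [h] at this
  have : k = j := le_antisymm (by exact_mod_cast this) hjk
  exact this ▸ hp

lemma mem_Ioo_of_lt_thresholdTime {k : ℕ} {ω : Ω} (hk : 1 ≤ k)
    (h : k < thresholdTime P H Z πl πu ω) :
    posterior P H Z k ω ∈ Set.Ioo (πl (Z k ω)) (πu (Z k ω)) := by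
  by_contra hp
  exact h.not_ge (thresholdTime_le_iff.2 ⟨k, le_rfl, hk, hp⟩)

lemma measurableSet_posterior_mem (hZ : ∀ k, Measurable (Z k)) {k : ℕ} (hk : 1 ≤ k)
    (p : Fin 4 → ℝ → Prop) :
    MeasurableSet[obsFiltration Z hZ k] {ω | p (Z k ω) (posterior P H Z k ω)} := by
  have : Measurable[obsFiltration Z hZ k] fun ω => p (Z k ω) (posterior P H Z k ω) :=
    measurable_of_forall_pathCylinder hZ fun ω ω' h => by
      rw [posterior_eq_of_mem h, h k (Finset.mem_Icc.2 ⟨hk, le_rfl⟩)]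
  exact @measurableSet_setOfPred _ (_) _ |>.2 this

lemma isAdmissibleTime_thresholdTime (hZ : ∀ k, Measurable (Z k)) :
    IsAdmissibleTime Z hZ (thresholdTime P H Z πl πu) := by
  refine ⟨fun k => ?_, one_le_thresholdTime⟩
  have : {ω | thresholdTime P H Z πl πu ω ≤ (k : ℕ)} = ⋃ j ∈ Finset.Icc 1 k,
      {ω | posterior P H Z j ω ∉ Set.Ioo (πl (Z j ω)) (πu (Z j ω))} := by
    ext ω
    simp only [Set.mem_ofPred_eq, thresholdTime_le_iff, Set.mem_iUnion, Finset.mem_Icc]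
    exact exists_congr fun j => by rw [exists_prop]; tauto
  change MeasurableSet[obsFiltration Z hZ k] {ω | thresholdTime P H Z πl πu ω ≤ (k : ℕ)}
  rw [this]
  refine @Finset.measurableSet_biUnion _ _ (_) _ _ fun j hj => ?_
  rw [Finset.mem_Icc] at hj
  exact (obsFiltration Z hZ).mono hj.2 _
    (measurableSet_posterior_mem hZ hj.1 fun z π => π ∉ Set.Ioo (πl z) (πu z))

lemma IsAdmissiblePolicy.measurableSet_inter {hZ : ∀ k, Measurable (Z k)} {T : Ω → ℕ∞}
    {δ : Ω → Fin 2} (h : IsAdmissiblePolicy Z hZ T δ) (j : Fin 2) (k : ℕ) :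
    MeasurableSet[obsFiltration Z hZ k] ({ω | δ ω = j} ∩ {ω | T ω = k}) := by
  obtain ⟨-, hT, hδ⟩ := h
  have h2 : MeasurableSet[hT.measurableSpace] ({ω | δ ω = j} ∩ {ω | T ω = k}) :=
    @MeasurableSet.inter _ (_) _ _ (hδ (measurableSet_singleton j)) (hT.measurableSet_eq' k)
  exact (hT.measurableSet_inter_eq_iff _ k).1 h2

lemma exists_thresholdDeclaration (hZ : ∀ k, Measurable (Z k)) :
    ∃ δ, IsAdmissiblePolicy Z hZ (thresholdTime P H Z πl πu) δ ∧
      IsThresholdDeclaration P H Z πl πu (thresholdTime P H Z πl πu) δ := by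
  classical
  set T := thresholdTime P H Z πl πu
  have hT : IsAdmissibleTime Z hZ T := isAdmissibleTime_thresholdTime hZ
  set B : ℕ → Set Ω := fun k => {ω | ¬ posterior P H Z k ω ≤ πl (Z k ω)} ∩ {ω | T ω = k}
  refine ⟨fun ω => if ω ∈ ⋃ k, B k then 1 else 0, ⟨hT.2, hT.1, ?_⟩, fun ω k hk => ?_⟩
  · refine @Measurable.ite _ _ (_) _ _ _ _ _ ?_ (@measurable_const _ _ _ (_) _)
      (@measurable_const _ _ _ (_) _)
    refine @MeasurableSet.iUnion _ _ (_) _ _ fun k => (hT.1.measurableSet_inter_eq_iff _ k).2 ?_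
    -- Time `0` is separate: `Z 0` is not observed, so measurability comes from `T = 0` being
    -- impossible.
    rcases Nat.eq_zero_or_pos k with rfl | hk
    · convert @MeasurableSet.empty _ (obsFiltration Z hZ 0)
      refine Set.eq_empty_iff_forall_notMem.2 fun ω h => ?_
      exact one_ne_zero (le_zero_iff.1 ((hT.2 ω).trans_eq h.2))
    · exact @MeasurableSet.inter _ (_) _ _
        (measurableSet_posterior_mem hZ hk fun z π => ¬ π ≤ πl z) (measurableSet_time_eq hT.1 k)
  · have hmem : ω ∈ ⋃ k, B k ↔ ¬ posterior P H Z k ω ≤ πl (Z k ω) := by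
      rw [Set.mem_iUnion]
      refine ⟨fun ⟨j, hj⟩ => ?_, fun h => ⟨k, h, hk⟩⟩
      have : j = k := by exact_mod_cast hj.2.symm.trans hk
      exact this ▸ hj.1
    by_cases hp : posterior P H Z k ω ≤ πl (Z k ω)
    · exact Or.inl ⟨if_neg (hmem.not.2 (not_not.2 hp)), hp⟩
    · refine Or.inr ⟨if_pos (hmem.2 hp), ?_⟩
      by_contra hu
      exact notMem_Ioo_of_thresholdTime_eq hk ⟨not_le.1 hp, not_le.1 hu⟩

/-- Before stopping, the posterior exceeds the smallest lower threshold `m > 0`. So `m P(T* = ∞) ≤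
E[Π_n; n < T*] = P(H = 1, n < T*)`, which tends to `0`. -/
lemma ae_thresholdTime_lt_top [IsProbabilityMeasure P] (hZ : ∀ k, Measurable (Z k))
    (hH : Measurable H) (hl : ∀ z, 0 < πl z)
    (hlim : Filter.Tendsto (fun n : ℕ => P ({ω | H ω = 1} ∩
      {ω | (n : ℕ∞) < thresholdTime P H Z πl πu ω})) Filter.atTop (nhds 0)) :
    ∀ᵐ ω ∂P, thresholdTime P H Z πl πu ω < ⊤ := by
  obtain ⟨z₀, hz₀⟩ := Finite.exists_min πl
  have hT := isAdmissibleTime_thresholdTime (P := P) (H := H) (πl := πl) (πu := πu) hZ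
  set T := thresholdTime P H Z πl πu
  have hle : ENNReal.ofReal (πl z₀) * P {ω | T ω = ⊤} ≤ 0 := by
    refine ge_of_tendsto hlim (Filter.eventually_atTop.2 ⟨1, fun n hn => ?_⟩)
    rw [← setLIntegral_posterior hZ hH (measurableSet_time_lt hT.1 n), ← setLIntegral_const]
    refine (lintegral_mono_set fun ω (h : T ω = ⊤) => ?_).trans
      (setLIntegral_mono' (measurableSet_time_lt' hT.1 n) fun ω h =>
        ENNReal.ofReal_le_ofReal ((hz₀ _).trans (mem_Ioo_of_lt_thresholdTime hn h).1.le))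
    change (n : ℕ∞) < T ω
    rw [h]
    exact ENat.natCast_lt_top n
  rw [ae_iff]
  simp only [not_lt_top_iff]
  exact (mul_eq_zero.1 (le_zero_iff.1 hle)).resolve_left (ENNReal.ofReal_pos.2 (hl z₀)).ne'

end ThresholdTime

theorem theorem2 (α : Fin 2 → Fin 4 → Fin 4 → ℝ) (hα : IsTransitionFamily α)
    (c cI cII : ℝ) (hc : 0 < c) (hcI : 0 < cI) (hcII : 0 < cII) :
    ∃ s : Fin 4 → ℝ → ℝ,
      -- `s` is the unique nonnegative solution of the Bellman equation
      IsBellmanSolution α c cI cII s ∧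
      (∀ s', IsBellmanSolution α c cI cII s' → ∀ z, Set.EqOn (s' z) (s z) (Set.Icc 0 1)) ∧
      -- the thresholds are a genuine supremum and infimum, and positive
      (∀ z, (newsSet cI cII s z).Nonempty ∧ (misinfoSet cI cII s z).Nonempty ∧
        0 < upperThreshold cI cII s z) ∧
      ((∀ z z', α 0 z z' = 0 → α 1 z z' = 0) → ∀ z, 0 < lowerThreshold cI cII s z) ∧
      -- the threshold time, with the threshold declaration, is optimal
      ∀ (Ω : Type*) [MeasurableSpace Ω] (P : Measure Ω) [IsProbabilityMeasure P] (π₁ : ℝ)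
        (H : Ω → Fin 2) (Z : ℕ → Ω → Fin 4) (hZ : ∀ k, Measurable (Z k)),
        IsObservationModel P π₁ α H Z →
        ∀ T' : Ω → ℕ∞,
          T' = thresholdTime P H Z (lowerThreshold cI cII s) (upperThreshold cI cII s) →
          IsAdmissibleTime Z hZ T' ∧
          (∀ T, IsAdmissibleTime Z hZ T →
            stoppingCost P H Z c cI cII T' ≤ stoppingCost P H Z c cI cII T) ∧
          (∃ δ', IsAdmissiblePolicy Z hZ T' δ' ∧
            IsThresholdDeclaration P H Z (lowerThreshold cI cII s) (upperThreshold cI cII s)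
              T' δ') ∧
          (∀ δ', IsAdmissiblePolicy Z hZ T' δ' →
            IsThresholdDeclaration P H Z (lowerThreshold cI cII s) (upperThreshold cI cII s)
              T' δ' →
            ∀ T δ, IsAdmissiblePolicy Z hZ T δ →
              detectionCost P H π₁ c cI cII T' δ' ≤ detectionCost P H π₁ c cI cII T δ) ∧
          ((∀ z z', α 0 z z' = 0 → α 1 z z' = 0) → ∀ᵐ ω ∂P, T' ω < ⊤) := by
  have hs := isBellmanSolution_bellmanLimit hα hc hcI hcII
  have hconc := concaveOn_bellmanLimit hα hc hcI hcII
  set s := bellmanLimit α c cI cII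
  refine ⟨s, hs, fun s' hs' z π hπ => le_antisymm
    (hs.le_of_isBellmanSolution hα hc hcII hs' z π hπ)
    (hs'.le_of_isBellmanSolution hα hc hcII hs z π hπ),
    fun z => ⟨⟨0, hs.zero_mem_newsSet hcI hcII z⟩, ⟨1, hs.one_mem_misinfoSet hcI hcII z⟩,
      hs.upperThreshold_pos hcI hcII z⟩, hs.lowerThreshold_pos hα hc hcI hcII, ?_⟩
  rintro Ω _ P _ π₁ H Z hZ hM _ rfl
  have hH := hM.measurable_hypothesis
  have hT' := isAdmissibleTime_thresholdTime (P := P) (H := H)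
    (πl := lowerThreshold cI cII s) (πu := upperThreshold cI cII s) hZ
  -- The threshold time continues only strictly between the thresholds, where `s < g`, and stops
  -- only outside, where `s = g`.
  have hloss := stoppedLoss_le_initialValue hα hs hc hZ hM hT'
    (fun ω k hk h => hs.lt_errorCost_of_mem_Ioo hcI hcII (posterior_mem_Icc hZ k ω)
      (mem_Ioo_of_lt_thresholdTime hk h))
    (fun ω k h => hs.eq_errorCost_of_notMem_Ioo hcI hcII hconc (posterior_mem_Icc hZ k ω)
      (notMem_Ioo_of_thresholdTime_eq h))
  refine ⟨hT', fun T hT => ?_, exists_thresholdDeclaration hZ, fun δ' hδ' hdecl T δ hδ => ?_,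
    fun habs => ?_⟩
  · rw [stoppingCost_eq_stoppedLoss hc hcII hZ hH hT'.1,
      stoppingCost_eq_stoppedLoss hc hcII hZ hH hT.1]
    exact hloss.trans (initialValue_le_stoppedLoss hα hs hc hZ hM hT)
  · rw [detectionCost_eq_stoppedLoss hcI hcII hZ hH hM.prior hT'.1 hδ'.measurableSet_inter
      (hs.lowerThreshold_le hcI hcII) (hs.le_upperThreshold hcI hcII) hdecl]
    have hT : IsAdmissibleTime Z hZ T := ⟨hδ.2.1, hδ.1⟩
    exact (hloss.trans (initialValue_le_stoppedLoss hα hs hc hZ hM hT)).trans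
      (stoppedLoss_le_detectionCost hcI hcII hZ hH hM.prior hT.1 hδ.measurableSet_inter)
  · exact ae_thresholdTime_lt_top hZ hH (hs.lowerThreshold_pos hα hc hcI hcII habs)
      (tendsto_measure_lt_of_stoppedLoss_ne_top hc
        (ne_top_of_le_ne_top (initialValue_ne_top hs hZ) hloss))
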